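/- For $t\in(0,4)$ put $$m_n(t)=e^{-nt/2}\sum_{k=0}^{n-1}\frac{(-t)^k}{k!}\,n^{k-1}\binom{n}{k+1}\quad(n\ge 1),\qquad \beta(t)=\tfrac12\sqrt{t(4-t)}+\arccos\bigl(1-\tfrac t2\bigr),$$ $$h_t(z)=(1-z)\,e^{t\left(\frac1z-\frac12\right)}\quad(z\in\mathbb C\setminus\{0\}).$$ The spectral measure $\mu_t$ of free unitary Brownian motion at time $t$ is the unique Borel probability measure on the unit circle $\mathbb T$ with $\int_{\mathbb T} z^n\,d\mu_t(z)=m_n(t)$ for all $n\ge1$. Let $\gamma_t$ be the unique piecewise smooth (i.e. piecewise $C^1$ with non-vanishing derivative) Jordan curve that encircles $0$, does not meet $[1,\infty)$ and satisfies $h_t(\gamma_t)\subset\mathbb T$, and let $\gamma_t^2=\{z\in\gamma_t:\ |z-1|\ge1\}$. For every $t\in(0,4)$, the measure $\mu_t$ and the curve $\gamma_t$ exist and are unique, one has $h_t(\gamma_t)=\{e^{i\theta}:|\theta|\le\beta(t)\}$, and the restriction $h_{t,2}$ of $h_t$ to $\gamma_t^2$ is a bijection from $\gamma_t^2$ onto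 $h_t(\gamma_t)$. The function $$\rho_t(\theta)=\frac2t\,\mathbf 1_{[-\beta(t),\beta(t)]}(\theta)\,\frac{\log\bigl|h_{t,2}^{-1}(e^{i\theta})-1\bigr|}{2\pi},\qquad\theta\in\mathbb R,$$ is continuous and nonnegative, and its support is $[-\beta(t),\beta(t)]$. The measure $\mu_t$ is absolutely continuous with respect to Haar measure on $\mathbb T$, and it is given by $d\mu_t(\theta)=\rho_t(\theta)\,d\theta$, that is, it is the image of the measure $\rho_t(\theta)\,d\theta$ under $\theta\mapsto e^{i\theta}$. Its support is the arc $\{e^{i\theta}:|\theta|\le\beta(t)\}$. -/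

import Mathlib

open MeasureTheory Set

noncomputable section

/-- The unit circle carries its Borel σ-algebra. -/
instance Circle.instMeasurableSpaceBorel : MeasurableSpace Circle := borel Circle

instance Circle.instBorelSpaceBorel : BorelSpace Circle := ⟨rfl⟩

namespace FreeUnitaryBM

/-- The moments `m_n(t)`, `n ≥ 1`, of free unitary Brownian motion at time `t`:
`m_n(t) = e^{-nt/2} ∑_{k=0}^{n-1} (-t)^k / k! * n^{k-1} * binom(n, k+1)`.
The exponent `k - 1` is an integer (it is `-1` for `k = 0`). -/
def moment (t : ℝ) (n : ℕ) : ℝ :=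
  Real.exp (-(n * t / 2)) *
    ∑ k ∈ Finset.range n,
      (-t) ^ k / (k.factorial : ℝ) * (n : ℝ) ^ ((k : ℤ) - 1) * (n.choose (k + 1) : ℝ)

/-- `μ` is the spectral distribution of free unitary Brownian motion at time `t`: the Borel
probability measure on the unit circle with `∫ z ^ n dμ = m_n(t)` for all `n ≥ 1`. (The moments
of negative order are the complex conjugates of these, and the moments determine `μ`.) -/
structure IsSpectralMeasure (t : ℝ) (μ : Measure Circle) : Prop where
  isProbabilityMeasure : IsProbabilityMeasure μ
  integral_pow : ∀ n : ℕ, 1 ≤ n → ∫ z : Circle, (z : ℂ) ^ n ∂μ = (moment t n : ℂ)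

/-- `h_t(z) = (1 - z) e^{t (1/z - 1/2)}`, a function on `ℂ \ {0}`. -/
def h (t : ℝ) (z : ℂ) : ℂ :=
  (1 - z) * Complex.exp (t * (1 / z - 1 / 2))

/-- `β(t) = (1/2) √(t (4 - t)) + arccos (1 - t/2)`. -/
def β (t : ℝ) : ℝ :=
  1 / 2 * Real.sqrt (t * (4 - t)) + Real.arccos (1 - t / 2)

/-- `γ` is (the trace of) a piecewise smooth Jordan curve in the plane: it has a continuous
parametrization on `[0, 1]` which is closed, has no other self-intersection, and is continuously
differentiable with nowhere vanishing derivative on each interval of some partition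
`0 = p 0 < p 1 < ⋯ < p N = 1`, one-sided derivatives being taken at the partition points. -/
def IsPiecewiseSmoothJordanCurve (γ : Set ℂ) : Prop :=
  ∃ c : ℝ → ℂ, ContinuousOn c (Icc 0 1) ∧ c 0 = c 1 ∧ InjOn c (Ico 0 1) ∧ c '' Icc 0 1 = γ ∧
    ∃ (N : ℕ) (p : ℕ → ℝ), p 0 = 0 ∧ p N = 1 ∧ ∀ i < N, p i < p (i + 1) ∧
      ContDiffOn ℝ 1 c (Icc (p i) (p (i + 1))) ∧
      ∀ s ∈ Icc (p i) (p (i + 1)), derivWithin c (Icc (p i) (p (i + 1))) s ≠ 0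

/-- `γ` encircles the point `a`: `a` is not on `γ` and lies in a bounded connected component of
the complement of `γ`. -/
def Encircles (γ : Set ℂ) (a : ℂ) : Prop :=
  a ∉ γ ∧ Bornology.IsBounded (connectedComponentIn γᶜ a)

/-- The properties that characterize the curve `γ_t`: it is a piecewise smooth Jordan curve around
the origin that does not meet `[1, ∞)` and that `h_t` maps into the unit circle. -/
structure IsCurve (t : ℝ) (γ : Set ℂ) : Prop where
  isPiecewiseSmoothJordanCurve : IsPiecewiseSmoothJordanCurve γ
  norm_h : ∀ z ∈ γ, ‖h t z‖ = 1
  encircles : Encircles γ 0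
  disjoint : Disjoint γ (Complex.ofReal '' Ici 1)

/-- The part `γ_t² = {z ∈ γ_t : |z - 1| ≥ 1}` of the curve. -/
def outerPart (γ : Set ℂ) : Set ℂ := {z ∈ γ | 1 ≤ ‖z - 1‖}

/-- `h_{t,2}⁻¹`, the inverse of the restriction `h_{t,2}` of `h_t` to `γ_t²`. (It is the inverse as
soon as `h_{t,2}` is injective, and is used only on the image of `h_{t,2}`.) -/
def hInv₂ (t : ℝ) (γ : Set ℂ) (w : ℂ) : ℂ := Function.invFunOn (h t) (outerPart γ) w

/-- `ρ_t(θ) = (2/t) 1_{[-β(t), β(t)]}(θ) log |h_{t,2}⁻¹(e^{iθ}) - 1| / (2π)`. -/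
def ρ (t : ℝ) (γ : Set ℂ) (θ : ℝ) : ℝ :=
  (Icc (-β t) (β t)).indicator
    (fun φ : ℝ => 2 / t * Real.log ‖hInv₂ t γ (Circle.exp φ : ℂ) - 1‖ / (2 * Real.pi)) θ

end FreeUnitaryBM

end

noncomputable section

namespace FreeUnitaryBM

open Filter Topology ComplexConjugate

/-! In the coordinate `v = 2 / z - 1 = x + i y`, `h t z` becomes `w t v = (v - 1) / (v + 1) * exp (t
v / 2)`, and `‖w t v‖ = 1` is the imaginary axis together with the oval `y ^ 2 = levelFun t x`
(`norm_w_eq_one_iff`). The curve `γ_t` is the image of the oval. A Jordan curve in the level set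
that avoids `v = 0` (that is, `z = 2`) cannot use the axis off the oval, since it would have to turn
back there, and a Jordan curve contained in the oval fills it (`IsCurve.eq_curveSet`).

The reflection `v ↦ -conj v` preserves `w` on the level set and exchanges the halves of the oval;
the left half gives `γ_t²`. On the right half the argument of `w` increases strictly from `-β t` to
`β t`, because the critical points of `log w` lie on the imaginary axis. Hence `h_{t,2}` is
bijective, and `‖h‖ = 1` turns `log ‖z - 1‖` into `t * Re v / 2` for the reflected point `v`
(`log_norm_outerArc`): the density at angle `θ` is `Re v / (2π)`.

For the moments, integration by parts reduces `∫ cos (n θ) Re v dθ` to the integral of `w ^ (-n) - w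
^ n` along the arc. Here `w ^ n` at `v` is `w ^ (-n)` at `-v`, and `w ^ (-n)` has residue `2 n
m_n(t)` at `v = 1` (`exists_primitive_w_inv_pow`). The single-valued parts of the primitive cancel
at the two opposite endpoints, and the logarithms leave `2π m_n(t)`. Fourier coefficients determine
the measure. -/

/-! ### Analytic quotients of hyperbolic functions -/

theorem analyticAt_dslope {f : ℝ → ℝ} (hf : ∀ x, AnalyticAt ℝ f x) (a x : ℝ) :
    AnalyticAt ℝ (dslope f a) x := by
  rcases eq_or_ne x a with rfl | h
  · obtain ⟨p, hp⟩ := hf x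
    exact hp.has_fpower_series_dslope_fslope.analyticAt
  · have h1 : AnalyticAt ℝ (fun y => (y - a)⁻¹ * (f y - f a)) x :=
      ((analyticAt_id.sub analyticAt_const).inv (sub_ne_zero.2 h)).mul
        ((hf x).sub analyticAt_const)
    refine h1.congr ?_
    filter_upwards [isOpen_ne.mem_nhds h] with y hy
    rw [dslope_of_ne _ hy, slope_def_field]
    field_simp

/-- `sinh x / x`, extended by `1` at `0`. -/
def sinhc (x : ℝ) : ℝ := dslope Real.sinh 0 x

theorem mul_sinhc (x : ℝ) : x * sinhc x = Real.sinh x := by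
  have := sub_smul_dslope Real.sinh 0 x
  simpa [sinhc] using this

theorem sinhc_zero : sinhc 0 = 1 := by simp [sinhc]

theorem analyticAt_sinhc (x : ℝ) : AnalyticAt ℝ sinhc x :=
  analyticAt_dslope (fun _ => Real.analyticAt_sinh) 0 x

theorem sinhc_pos (x : ℝ) : 0 < sinhc x := by
  rcases lt_trichotomy x 0 with h | rfl | h
  · have h1 := mul_sinhc x
    have h2 := Real.sinh_neg_iff.2 h
    nlinarith
  · simp [sinhc_zero]
  · have h1 := mul_sinhc x
    have h2 := Real.sinh_pos_iff.2 h
    nlinarith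

theorem sinhc_neg (x : ℝ) : sinhc (-x) = sinhc x := by
  rcases eq_or_ne x 0 with rfl | h
  · simp
  · have h1 := mul_sinhc x
    have h2 := mul_sinhc (-x)
    rw [Real.sinh_neg, ← h1] at h2
    apply mul_left_cancel₀ h
    linarith

theorem sinh_lt_mul_cosh {x : ℝ} (hx : 0 < x) : Real.sinh x < x * Real.cosh x := by
  have hd : ∀ y, HasDerivAt (fun y => y * Real.cosh y - Real.sinh y) (y * Real.sinh y) y := by
    intro y
    exact (((hasDerivAt_id' y).fun_mul (Real.hasDerivAt_cosh y)).fun_sub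
      (Real.hasDerivAt_sinh y)).congr_deriv (by ring)
  have hm : StrictMonoOn (fun y => y * Real.cosh y - Real.sinh y) (Ici 0) := by
    apply strictMonoOn_of_deriv_pos (convex_Ici 0)
    · exact fun y _ => (hd y).continuousAt.continuousWithinAt
    · intro y hy
      rw [interior_Ici] at hy
      rw [(hd y).deriv]
      exact mul_pos hy (Real.sinh_pos_iff.2 hy)
  have := hm (self_mem_Ici) hx.le hx
  simp at this
  linarith

theorem sinhc_le_cosh (x : ℝ) : sinhc x ≤ Real.cosh x := by
  have key : ∀ y : ℝ, 0 < y → sinhc y ≤ Real.cosh y := by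
    intro y hy
    have := sinh_lt_mul_cosh hy
    rw [← mul_sinhc] at this
    exact (lt_of_mul_lt_mul_left this hy.le).le
  rcases lt_trichotomy x 0 with h | rfl | h
  · have := key (-x) (by linarith)
    rwa [sinhc_neg, Real.cosh_neg] at this
  · simp [sinhc_zero]
  · exact key x h

/-- `tanh (t x / 4) / x`, extended by `t / 4` at `0`. -/
def tanhRatio (t x : ℝ) : ℝ := t / 4 * sinhc (t / 4 * x) / Real.cosh (t / 4 * x)

theorem tanhRatio_zero (t : ℝ) : tanhRatio t 0 = t / 4 := by simp [tanhRatio, sinhc_zero]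

theorem tanhRatio_neg (t x : ℝ) : tanhRatio t (-x) = tanhRatio t x := by
  simp [tanhRatio, sinhc_neg]

theorem tanhRatio_pos {t : ℝ} (ht : 0 < t) (x : ℝ) : 0 < tanhRatio t x :=
  div_pos (mul_pos (by linarith) (sinhc_pos _)) (Real.cosh_pos _)

theorem tanhRatio_le {t : ℝ} (ht : 0 < t) (x : ℝ) : tanhRatio t x ≤ t / 4 := by
  rw [tanhRatio, div_le_iff₀ (Real.cosh_pos _)]
  exact mul_le_mul_of_nonneg_left (sinhc_le_cosh _) (by linarith)

theorem tanhRatio_lt_one {t : ℝ} (ht : 0 < t) (ht4 : t < 4) (x : ℝ) : tanhRatio t x < 1 :=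
  (tanhRatio_le ht x).trans_lt (by linarith)

theorem mul_tanhRatio_mul_cosh (t x : ℝ) :
    x * tanhRatio t x * Real.cosh (t / 4 * x) = Real.sinh (t / 4 * x) := by
  have := mul_sinhc (t / 4 * x)
  have h := (Real.cosh_pos (t / 4 * x)).ne'
  rw [tanhRatio, ← this]
  field_simp

theorem analyticAt_tanhRatio (t x : ℝ) : AnalyticAt ℝ (tanhRatio t) x := by
  have h1 : AnalyticAt ℝ (fun y : ℝ => t / 4 * y) x := analyticAt_const.mul analyticAt_id
  have h2 : AnalyticAt ℝ (fun y : ℝ => sinhc (t / 4 * y)) x :=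
    (analyticAt_sinhc _).comp (f := fun y : ℝ => t / 4 * y) h1
  have h3 : AnalyticAt ℝ (fun y : ℝ => Real.cosh (t / 4 * y)) x :=
    Real.analyticAt_cosh.comp (f := fun y : ℝ => t / 4 * y) h1
  exact (analyticAt_const.mul h2).div h3 (Real.cosh_pos _).ne'

/-! ### The level function, its sign and its zeros -/

/-- `1 - x tanh (t x / 4)`. -/
def outerFactor (t x : ℝ) : ℝ := 1 - x ^ 2 * tanhRatio t x

/-- The points `x + i y` with `y ^ 2 = levelFun t x` form the compact component of the level set
`‖(v - 1) / (v + 1) * exp (t v / 2)‖ = 1`. -/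
def levelFun (t x : ℝ) : ℝ := outerFactor t x * (1 / tanhRatio t x - 1)

theorem outerFactor_neg (t x : ℝ) : outerFactor t (-x) = outerFactor t x := by
  simp [outerFactor, tanhRatio_neg]

theorem levelFun_neg (t x : ℝ) : levelFun t (-x) = levelFun t x := by
  simp [levelFun, outerFactor_neg, tanhRatio_neg]

theorem levelFun_zero (t : ℝ) : levelFun t 0 = 4 / t - 1 := by
  simp [levelFun, outerFactor, tanhRatio_zero]

theorem analyticAt_outerFactor (t x : ℝ) : AnalyticAt ℝ (outerFactor t) x :=
  analyticAt_const.sub ((analyticAt_id.pow 2).mul (analyticAt_tanhRatio t x))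

theorem analyticAt_levelFun {t : ℝ} (ht : 0 < t) (x : ℝ) : AnalyticAt ℝ (levelFun t) x :=
  (analyticAt_outerFactor t x).mul
    ((analyticAt_const.div (analyticAt_tanhRatio t x) (tanhRatio_pos ht x).ne').sub
      analyticAt_const)

theorem continuous_levelFun {t : ℝ} (ht : 0 < t) : Continuous (levelFun t) :=
  continuous_iff_continuousAt.2 fun x => (analyticAt_levelFun ht x).continuousAt

theorem outerFactor_eq (t x : ℝ) : outerFactor t x = 1 - x * Real.tanh (t / 4 * x) := by
  have h := (Real.cosh_pos (t / 4 * x)).ne'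
  rw [outerFactor, Real.tanh_eq_sinh_div_cosh, ← mul_tanhRatio_mul_cosh]
  field_simp

theorem hasDerivAt_outerFactor (t x : ℝ) : HasDerivAt (outerFactor t)
    (-(Real.tanh (t / 4 * x) + x * (t / 4 / Real.cosh (t / 4 * x) ^ 2))) x := by
  have h := (Real.cosh_pos (t / 4 * x)).ne'
  have h1 : HasDerivAt (fun y : ℝ => t / 4 * y) (t / 4) x := by
    simpa using (hasDerivAt_id x).const_mul (t / 4)
  have h2 := ((hasDerivAt_id' x).fun_mul (h1.sinh.fun_div h1.cosh h)).const_sub 1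
  have he : outerFactor t = fun y => 1 - y * (Real.sinh (t / 4 * y) / Real.cosh (t / 4 * y)) := by
    ext y
    rw [outerFactor_eq, Real.tanh_eq_sinh_div_cosh]
  rw [he]
  refine h2.congr_deriv ?_
  rw [Real.tanh_eq_sinh_div_cosh]
  field_simp
  rw [Real.cosh_sq (t * x / 4)]
  ring

theorem strictAntiOn_outerFactor {t : ℝ} (ht : 0 < t) :
    StrictAntiOn (outerFactor t) (Ici 0) := by
  apply strictAntiOn_of_deriv_neg (convex_Ici 0)
  · exact fun y _ => (hasDerivAt_outerFactor t y).continuousAt.continuousWithinAt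
  · intro y hy
    rw [interior_Ici, mem_Ioi] at hy
    rw [(hasDerivAt_outerFactor t y).deriv]
    have h1 : 0 < Real.tanh (t / 4 * y) := by
      rw [Real.tanh_eq_sinh_div_cosh]
      exact div_pos (Real.sinh_pos_iff.2 (by positivity)) (Real.cosh_pos _)
    have : 0 < y * (t / 4 / Real.cosh (t / 4 * y) ^ 2) := by positivity
    linarith

theorem exists_outerFactor_eq_zero {t : ℝ} (ht : 0 < t) : ∃ x, 1 < x ∧ outerFactor t x = 0 := by
  have hc : ContinuousOn (outerFactor t) (Icc 1 (2 + 8 / t)) :=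
    fun y _ => (hasDerivAt_outerFactor t y).continuousAt.continuousWithinAt
  have h1 : 0 < outerFactor t 1 := by
    have := Real.tanh_lt_one (t / 4 * 1)
    rw [outerFactor_eq]; linarith
  have h8 : 0 < 8 / t := by positivity
  -- At `x = 2 + 8 / t` the argument `t / 4 * x` is `t / 2 + 2`, where `tanh` is at least `1 / 2`,
  -- while `x ≥ 2`.
  have h2 : outerFactor t (2 + 8 / t) ≤ 0 := by
    have h3 : (1 : ℝ) / 2 ≤ Real.tanh (t / 4 * (2 + 8 / t)) := by
      have ha : t / 4 * (2 + 8 / t) = t / 2 + 2 := by field_simp; ring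
      rw [ha, Real.tanh_eq, div_le_div_iff₀ (by norm_num) (by positivity)]
      have e1 : (3 : ℝ) ≤ Real.exp (t / 2 + 2) := by
        have := Real.add_one_le_exp (t / 2 + 2); linarith
      have e2 : Real.exp (-(t / 2 + 2)) ≤ 1 := Real.exp_le_one_iff.2 (by linarith)
      linarith
    rw [outerFactor_eq]
    nlinarith
  obtain ⟨x, hx, hx0⟩ := intermediate_value_Icc' (by linarith) hc ⟨h2, h1.le⟩
  refine ⟨x, lt_of_le_of_ne hx.1 ?_, hx0⟩
  rintro rfl
  linarith

open Classical in
/-- The positive zero of `levelFun t`. -/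
def endpt (t : ℝ) : ℝ := if ht : 0 < t then (exists_outerFactor_eq_zero ht).choose else 2

theorem one_lt_endpt (t : ℝ) : 1 < endpt t := by
  unfold endpt
  split_ifs with ht
  · exact (exists_outerFactor_eq_zero ht).choose_spec.1
  -- The default value `2` keeps the bound free of a condition on `t`.
  · norm_num

theorem outerFactor_endpt {t : ℝ} (ht : 0 < t) : outerFactor t (endpt t) = 0 := by
  unfold endpt
  rw [dif_pos ht]
  exact (exists_outerFactor_eq_zero ht).choose_spec.2

theorem endpt_pos (t : ℝ) : 0 < endpt t := zero_lt_one.trans (one_lt_endpt t)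

theorem outerFactor_abs (t x : ℝ) : outerFactor t |x| = outerFactor t x := by
  rcases abs_choice x with h | h <;> rw [h]
  exact outerFactor_neg t x

theorem outerFactor_pos_iff {t : ℝ} (ht : 0 < t) {x : ℝ} :
    0 < outerFactor t x ↔ |x| < endpt t := by
  rw [← outerFactor_abs, ← outerFactor_endpt ht]
  exact (strictAntiOn_outerFactor ht).lt_iff_gt (endpt_pos t).le (abs_nonneg x)

theorem outerFactor_nonneg_iff {t : ℝ} (ht : 0 < t) {x : ℝ} :
    0 ≤ outerFactor t x ↔ |x| ≤ endpt t := by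
  rw [← outerFactor_abs, ← outerFactor_endpt ht]
  exact (strictAntiOn_outerFactor ht).le_iff_ge (endpt_pos t).le (abs_nonneg x)

/-- For `t < 4` the sign of `levelFun t` is therefore that of `outerFactor t`, so the oval lies over
`[-endpt t, endpt t]` and closes up exactly at the ends. -/
theorem innerFactor_pos {t : ℝ} (ht : 0 < t) (ht4 : t < 4) (x : ℝ) :
    0 < 1 / tanhRatio t x - 1 := by
  rw [sub_pos, lt_div_iff₀ (tanhRatio_pos ht x), one_mul]
  exact tanhRatio_lt_one ht ht4 x

theorem levelFun_pos_iff {t : ℝ} (ht : 0 < t) (ht4 : t < 4) {x : ℝ} :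
    0 < levelFun t x ↔ |x| < endpt t := by
  rw [levelFun, mul_pos_iff_of_pos_right (innerFactor_pos ht ht4 x), outerFactor_pos_iff ht]

theorem levelFun_nonneg_iff {t : ℝ} (ht : 0 < t) (ht4 : t < 4) {x : ℝ} :
    0 ≤ levelFun t x ↔ |x| ≤ endpt t := by
  rw [levelFun, mul_nonneg_iff_of_pos_right (innerFactor_pos ht ht4 x), outerFactor_nonneg_iff ht]

theorem levelFun_endpt {t : ℝ} (ht : 0 < t) : levelFun t (endpt t) = 0 := by
  rw [levelFun, outerFactor_endpt ht, zero_mul]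

/-- The quotient `levelFun t x / (endpt t - x)`, extended analytically. -/
def levelQuot (t x : ℝ) : ℝ :=
  -dslope (outerFactor t) (endpt t) x * (1 / tanhRatio t x - 1)

theorem sub_mul_levelQuot {t : ℝ} (ht : 0 < t) (x : ℝ) :
    (endpt t - x) * levelQuot t x = levelFun t x := by
  have := sub_smul_dslope (outerFactor t) (endpt t) x
  rw [outerFactor_endpt ht, sub_zero, smul_eq_mul] at this
  rw [levelFun, levelQuot, ← this]
  ring

theorem analyticAt_levelQuot {t : ℝ} (ht : 0 < t) (x : ℝ) : AnalyticAt ℝ (levelQuot t) x :=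
  (analyticAt_dslope (analyticAt_outerFactor t) _ _).neg.mul
    ((analyticAt_const.div (analyticAt_tanhRatio t x) (tanhRatio_pos ht x).ne').sub
      analyticAt_const)

/-- Before the vertex the quotient has the sign of `levelFun t`; at the vertex it is minus the
derivative of `outerFactor t` times a positive factor, so the zero is simple. This makes the square
root in `arc` smooth there. -/
theorem levelQuot_pos {t : ℝ} (ht : 0 < t) (ht4 : t < 4) {x : ℝ} (h0 : -endpt t < x)
    (hx : x ≤ endpt t) : 0 < levelQuot t x := by
  rcases hx.lt_or_eq with h | rfl
  · have h1 := (levelFun_pos_iff ht ht4 (x := x)).2 (abs_lt.2 ⟨h0, h⟩)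
    rw [← sub_mul_levelQuot ht] at h1
    exact pos_of_mul_pos_right h1 (by linarith)
  · refine mul_pos ?_ (innerFactor_pos ht ht4 _)
    rw [dslope_same, (hasDerivAt_outerFactor t _).deriv, neg_neg]
    have hp := endpt_pos t
    have h1 : 0 < Real.tanh (t / 4 * endpt t) := by
      rw [Real.tanh_eq_sinh_div_cosh]
      exact div_pos (Real.sinh_pos_iff.2 (by positivity)) (Real.cosh_pos _)
    positivity

/-- The level set identity. -/
theorem sub_levelFun_mul_sinh {t : ℝ} (ht : 0 < t) (x y : ℝ) :
    (y ^ 2 - levelFun t x) * Real.sinh (t * x / 2) =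
      (x ^ 2 + y ^ 2 + 1) * Real.sinh (t * x / 2) - 2 * x * Real.cosh (t * x / 2) := by
  have h1 : t * x / 2 = 2 * (t / 4 * x) := by ring
  have h := mul_tanhRatio_mul_cosh t x
  have hT := (tanhRatio_pos ht x).ne'
  -- With `T = tanh (t x / 4) / x`, the double-angle formulas give `2 x coth (t x / 2) = 1 / T + x ^
  -- 2 T`; subtracting `x ^ 2 + 1` leaves `(1 - x ^ 2 T) (1 / T - 1)`.
  rw [h1, Real.sinh_two_mul, Real.cosh_two_mul, levelFun, outerFactor, ← h]
  field_simp
  ring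

/-! ### The coordinate `v` and the level set `‖w‖ = 1` -/

/-- `h t` in the coordinate `v = 2 / z - 1`. -/
def w (t : ℝ) (v : ℂ) : ℂ := (v - 1) / (v + 1) * Complex.exp (t * v / 2)

theorem h_eq_w (t : ℝ) {z : ℂ} (hz : z ≠ 0) : h t z = w t (2 / z - 1) := by
  rw [h, w]
  congr 1
  · field_simp
    ring
  · congr 1
    field_simp

theorem h_two_div (t : ℝ) {v : ℂ} (hv : v ≠ -1) : h t (2 / (v + 1)) = w t v := by
  have h1 : v + 1 ≠ 0 := fun h => hv (eq_neg_of_add_eq_zero_left h)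
  rw [h_eq_w t (div_ne_zero two_ne_zero h1)]
  congr 1
  field_simp
  ring

theorem w_neg (t : ℝ) (v : ℂ) : w t (-v) = (w t v)⁻¹ := by
  rw [w, w, mul_inv, inv_div, ← Complex.exp_neg]
  congr 1
  · rw [← neg_div_neg_eq]
    congr 1 <;> ring
  · congr 1
    ring

theorem w_conj (t : ℝ) (v : ℂ) : w t (conj v) = conj (w t v) := by
  simp [w, ← Complex.exp_conj, Complex.conj_ofNat]

/-- Negating `v` inverts `w` and conjugating `v` conjugates it; on the unit circle the two effects
cancel. Thus both halves of the oval carry the same values. -/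
theorem w_neg_conj {t : ℝ} {v : ℂ} (hv : ‖w t v‖ = 1) : w t (-conj v) = w t v := by
  rw [w_neg, w_conj, ← Complex.inv_eq_conj hv, inv_inv]

/-- The oval `y ^ 2 = levelFun t x`. -/
def oval (t : ℝ) : Set ℂ := {v | v.im ^ 2 = levelFun t v.re}

theorem mem_oval {t : ℝ} {v : ℂ} : v ∈ oval t ↔ v.im ^ 2 = levelFun t v.re := Iff.rfl

theorem conj_mem_oval {t : ℝ} {v : ℂ} (hv : v ∈ oval t) : conj v ∈ oval t := by
  simpa [mem_oval] using hv

theorem neg_mem_oval {t : ℝ} {v : ℂ} (hv : v ∈ oval t) : -v ∈ oval t := by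
  simpa [mem_oval, levelFun_neg] using hv

theorem abs_re_le_of_mem_oval {t : ℝ} (ht : 0 < t) (ht4 : t < 4) {v : ℂ} (hv : v ∈ oval t) :
    |v.re| ≤ endpt t := by
  rw [← levelFun_nonneg_iff ht ht4, ← mem_oval.1 hv]
  positivity

theorem abs_re_eq_of_mem_oval {t : ℝ} (ht : 0 < t) (ht4 : t < 4) {v : ℂ} (hv : v ∈ oval t)
    (h0 : v.im = 0) : |v.re| = endpt t := by
  refine le_antisymm (abs_re_le_of_mem_oval ht ht4 hv) (not_lt.1 fun h => ?_)
  have := (levelFun_pos_iff ht ht4).2 h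
  rw [← mem_oval.1 hv, h0] at this
  simp at this

theorem im_ne_zero_of_mem_oval {t : ℝ} (ht : 0 < t) (ht4 : t < 4) {v : ℂ} (hv : v ∈ oval t)
    (h0 : |v.re| < endpt t) : v.im ≠ 0 :=
  fun h => h0.ne (abs_re_eq_of_mem_oval ht ht4 hv h)

theorem ofReal_notMem_oval {t : ℝ} (ht : 0 < t) (ht4 : t < 4) {x : ℝ} (hx : |x| ≤ 1) :
    (x : ℂ) ∉ oval t := fun h => by
  have := abs_re_eq_of_mem_oval ht ht4 h (Complex.ofReal_im x)
  have := one_lt_endpt t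
  simp at *
  linarith

theorem ne_neg_one_of_mem_oval {t : ℝ} (ht : 0 < t) (ht4 : t < 4) {v : ℂ} (hv : v ∈ oval t) :
    v ≠ -1 := by
  rintro rfl
  refine ofReal_notMem_oval ht ht4 (x := -1) (by simp) ?_
  simpa using hv

/-- After squaring, the condition reads `(x ^ 2 + y ^ 2 + 1) sinh (t x / 2) = 2 x cosh (t x / 2)`,
which by the level set identity is `(y ^ 2 - levelFun t x) sinh (t x / 2) = 0`. The factor `sinh`
accounts for the imaginary axis. -/
theorem norm_w_eq_one_iff {t : ℝ} (ht : 0 < t) {v : ℂ} (hv : v ≠ -1) :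
    ‖w t v‖ = 1 ↔ v.re = 0 ∨ v ∈ oval t := by
  have h1 : v + 1 ≠ 0 := fun h => hv (eq_neg_of_add_eq_zero_left h)
  have e1 : ‖w t v‖ = 1 ↔ ‖v - 1‖ ^ 2 * Real.exp (t * v.re / 2) ^ 2 = ‖v + 1‖ ^ 2 := by
    have hp : 0 < ‖v + 1‖ := norm_pos_iff.2 h1
    have hre : ((t : ℂ) * v / 2).re = t * v.re / 2 := by
      rw [show (t : ℂ) * v / 2 = ((t / 2 : ℝ) : ℂ) * v by push_cast; ring,
        Complex.re_ofReal_mul]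
      ring
    rw [w, norm_mul, norm_div, Complex.norm_exp, hre, div_mul_eq_mul_div, div_eq_one_iff_eq hp.ne',
      ← mul_pow]
    exact (sq_eq_sq₀ (by positivity) hp.le).symm
  have e2 : Real.exp (t * v.re / 2) * Real.exp (-(t * v.re / 2)) = 1 := by
    rw [← Real.exp_add]; simp
  have key := sub_levelFun_mul_sinh ht v.re v.im
  rw [Real.sinh_eq, Real.cosh_eq] at key
  have hs : v.re = 0 ↔ Real.sinh (t * v.re / 2) = 0 := by
    rw [Real.sinh_eq_zero]
    constructor
    · intro h; simp [h]
    · intro h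
      have : t * v.re = 0 := by linarith
      exact (mul_eq_zero.1 this).resolve_left ht.ne'
  rw [e1, hs, mem_oval, ← sub_eq_zero (a := v.im ^ 2), or_comm, ← mul_eq_zero, Complex.sq_norm,
    Complex.sq_norm, Complex.normSq_apply, Complex.normSq_apply, Real.sinh_eq]
  simp only [Complex.sub_re, Complex.sub_im, Complex.add_re, Complex.add_im, Complex.one_re,
    Complex.one_im]
  rw [key]
  have hE := Real.exp_pos (t * v.re / 2)
  constructor
  · intro h
    apply mul_left_cancel₀ hE.ne'
    linear_combination h / 2 - (v.re ^ 2 + v.im ^ 2 + 1 + 2 * v.re) / 2 * e2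
  · intro h
    linear_combination 2 * Real.exp (t * v.re / 2) * h
      + (v.re ^ 2 + v.im ^ 2 + 1 + 2 * v.re) * e2

/-! ### A regular parametrization of the right half of the oval -/

/-- The right half of the oval, parametrized by `[-√(endpt t), √(endpt t)]`. -/
def arc (t s : ℝ) : ℂ :=
  ((endpt t - s ^ 2 : ℝ) : ℂ) + ((s * √(levelQuot t (endpt t - s ^ 2)) : ℝ) : ℂ) * Complex.I

@[simp] theorem arc_re (t s : ℝ) : (arc t s).re = endpt t - s ^ 2 := by
  simp [arc, -Complex.ofReal_pow]

@[simp] theorem arc_im (t s : ℝ) :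
    (arc t s).im = s * √(levelQuot t (endpt t - s ^ 2)) := by
  simp [arc, -Complex.ofReal_pow]

theorem arc_neg (t s : ℝ) : arc t (-s) = conj (arc t s) := by
  apply Complex.ext <;> simp

section

variable {t : ℝ}

/-- The range `s ^ 2 < 2 * endpt t` is an open neighbourhood of the parameter interval, so
derivatives at the ends of the arc are two-sided. -/
theorem levelQuot_arc_pos (ht : 0 < t) (ht4 : t < 4) {s : ℝ} (hs : s ^ 2 < 2 * endpt t) :
    0 < levelQuot t (endpt t - s ^ 2) :=
  levelQuot_pos ht ht4 (by linarith) (by nlinarith)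

theorem arc_mem_oval (ht : 0 < t) (ht4 : t < 4) {s : ℝ} (hs : s ^ 2 < 2 * endpt t) :
    arc t s ∈ oval t := by
  rw [mem_oval, arc_re, arc_im, mul_pow, Real.sq_sqrt (levelQuot_arc_pos ht ht4 hs).le,
    ← sub_mul_levelQuot ht]
  ring

theorem arc_im_eq_zero_iff (ht : 0 < t) (ht4 : t < 4) {s : ℝ} (hs : s ^ 2 < 2 * endpt t) :
    (arc t s).im = 0 ↔ s = 0 := by
  rw [arc_im, mul_eq_zero, or_iff_left]
  exact (Real.sqrt_pos.2 (levelQuot_arc_pos ht ht4 hs)).ne'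

theorem contDiffAt_arc (ht : 0 < t) (ht4 : t < 4) {s : ℝ} (hs : s ^ 2 < 2 * endpt t) :
    ContDiffAt ℝ 1 (arc t) s := by
  have h1 : ContDiffAt ℝ 1 (fun s : ℝ => endpt t - s ^ 2) s :=
    (contDiff_const.sub (contDiff_id.pow 2)).contDiffAt
  have h2 : ContDiffAt ℝ 1 (fun s : ℝ => levelQuot t (endpt t - s ^ 2)) s :=
    ContDiffAt.comp (g := levelQuot t) s (analyticAt_levelQuot ht _).contDiffAt h1
  have h3 := contDiffAt_id.mul (h2.sqrt (levelQuot_arc_pos ht ht4 hs).ne')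
  exact (Complex.ofRealCLM.contDiff.contDiffAt.comp s h1).add
    ((Complex.ofRealCLM.contDiff.contDiffAt.comp s h3).mul contDiffAt_const)

theorem hasDerivAt_arc (ht : 0 < t) (ht4 : t < 4) {s : ℝ} (hs : s ^ 2 < 2 * endpt t) :
    HasDerivAt (arc t) (deriv (arc t) s) s :=
  ((contDiffAt_arc ht ht4 hs).differentiableAt (by norm_num)).hasDerivAt

theorem deriv_arc_re (ht : 0 < t) (ht4 : t < 4) {s : ℝ} (hs : s ^ 2 < 2 * endpt t) :
    (deriv (arc t) s).re = -2 * s := by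
  have h1 := Complex.reCLM.hasFDerivAt.comp_hasDerivAt s (hasDerivAt_arc ht ht4 hs)
  have h2 : HasDerivAt (fun s : ℝ => endpt t - s ^ 2) (-2 * s) s := by
    simpa using (hasDerivAt_pow 2 s).const_sub (endpt t)
  refine h1.unique (h2.congr_of_eventuallyEq (Eventually.of_forall fun s => ?_))
  simp

theorem deriv_arc_zero (ht : 0 < t) (ht4 : t < 4) :
    deriv (arc t) 0 = (√(levelQuot t (endpt t)) : ℂ) * Complex.I := by
  have hs : (0 : ℝ) ^ 2 < 2 * endpt t := by simpa using endpt_pos t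
  have h1 := Complex.imCLM.hasFDerivAt.comp_hasDerivAt (0 : ℝ) (hasDerivAt_arc ht ht4 hs)
  have hc : ContinuousAt (fun s : ℝ => √(levelQuot t (endpt t - s ^ 2))) 0 := by
    have : ContinuousAt (fun s : ℝ => levelQuot t (endpt t - s ^ 2)) 0 :=
      ContinuousAt.comp (g := levelQuot t) (analyticAt_levelQuot ht _).continuousAt
        (by fun_prop)
    exact this.sqrt
  have h2 : HasDerivAt (fun s : ℝ => s * √(levelQuot t (endpt t - s ^ 2)))
      (√(levelQuot t (endpt t))) 0 := by
    rw [hasDerivAt_iff_tendsto_slope_zero]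
    have : Tendsto (fun s : ℝ => √(levelQuot t (endpt t - s ^ 2))) (𝓝[≠] 0)
        (𝓝 (√(levelQuot t (endpt t)))) := by
      simpa using hc.tendsto.mono_left nhdsWithin_le_nhds
    refine this.congr' ?_
    filter_upwards [self_mem_nhdsWithin] with s hs
    have : s ≠ 0 := hs
    simp
    field_simp
  have h3 : (deriv (arc t) 0).im = √(levelQuot t (endpt t)) := by
    refine h1.unique (h2.congr_of_eventuallyEq (Eventually.of_forall fun s => ?_))
    simp
  apply Complex.ext
  · simp [deriv_arc_re ht ht4 hs]
  · simp [h3]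

/-- The real part moves when `s ≠ 0`; at the vertex `s = 0` it is stationary, but the imaginary part
moves because the zero of `levelFun t` is simple. -/
theorem deriv_arc_ne_zero (ht : 0 < t) (ht4 : t < 4) {s : ℝ} (hs : s ^ 2 < 2 * endpt t) :
    deriv (arc t) s ≠ 0 := by
  rcases eq_or_ne s 0 with rfl | h0
  · rw [deriv_arc_zero ht ht4]
    have := Real.sqrt_pos.2 (levelQuot_pos ht ht4 (by linarith [endpt_pos t]) (le_refl (endpt t)))
    simp [this.ne']
  · intro h
    have := deriv_arc_re ht ht4 hs
    rw [h] at this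
    simp at this
    exact h0 this

theorem arc_injOn (ht : 0 < t) (ht4 : t < 4) :
    InjOn (arc t) {s | s ^ 2 < 2 * endpt t} := by
  intro s hs s' hs' h
  have h1 := congrArg Complex.re h
  have h2 := congrArg Complex.im h
  rw [arc_re, arc_re] at h1
  rw [arc_im, arc_im, ← h1] at h2
  exact mul_right_cancel₀ (Real.sqrt_pos.2 (levelQuot_arc_pos ht ht4 hs)).ne' h2

theorem sq_le_iff_mem_Icc {s : ℝ} :
    s ^ 2 ≤ endpt t ↔ s ∈ Icc (-√(endpt t)) (√(endpt t)) := by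
  rw [Real.sq_le (endpt_pos t).le, mem_Icc]

theorem sq_lt_of_mem_Icc {s : ℝ} (hs : s ∈ Icc (-√(endpt t)) (√(endpt t))) :
    s ^ 2 < 2 * endpt t := by
  have := sq_le_iff_mem_Icc.2 hs
  have := endpt_pos t
  linarith

theorem sq_lt_iff_mem_Ioo {s : ℝ} :
    s ^ 2 < endpt t ↔ s ∈ Ioo (-√(endpt t)) (√(endpt t)) := by
  rw [Real.sq_lt, mem_Ioo]

theorem image_arc (ht : 0 < t) (ht4 : t < 4) :
    arc t '' Icc (-√(endpt t)) (√(endpt t)) = {v ∈ oval t | 0 ≤ v.re} := by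
  ext v
  constructor
  · rintro ⟨s, hs, rfl⟩
    refine ⟨arc_mem_oval ht ht4 (sq_lt_of_mem_Icc hs), ?_⟩
    rw [arc_re]
    linarith [sq_le_iff_mem_Icc.2 hs]
  · rintro ⟨hv, h0⟩
    have hle := abs_re_le_of_mem_oval ht ht4 hv
    rw [abs_of_nonneg h0] at hle
    have hq := levelQuot_pos ht ht4 (x := v.re) (by linarith [endpt_pos t]) hle
    have hsq : (v.im / √(levelQuot t v.re)) ^ 2 = endpt t - v.re := by
      rw [div_pow, Real.sq_sqrt hq.le, mem_oval.1 hv, ← sub_mul_levelQuot ht]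
      field_simp
    refine ⟨v.im / √(levelQuot t v.re), sq_le_iff_mem_Icc.1 (by rw [hsq]; linarith), ?_⟩
    apply Complex.ext
    · rw [arc_re, hsq]; ring
    · rw [arc_im, hsq, sub_sub_cancel]
      have := (Real.sqrt_pos.2 hq).ne'
      field_simp

/-- The ordinate at which the oval meets the imaginary axis. -/
def crossing (t : ℝ) : ℝ := √(4 / t - 1)

theorem crossing_pos (ht : 0 < t) (ht4 : t < 4) : 0 < crossing t := by
  apply Real.sqrt_pos.2
  rw [sub_pos, lt_div_iff₀ ht]
  linarith

theorem crossing_sq (ht : 0 < t) (ht4 : t < 4) : crossing t ^ 2 = 4 / t - 1 := by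
  have := crossing_pos ht ht4
  exact Real.sq_sqrt (Real.sqrt_pos.1 this).le

theorem arc_sqrt (ht : 0 < t) : arc t (√(endpt t)) = crossing t * Complex.I := by
  have h := Real.sq_sqrt (endpt_pos t).le
  apply Complex.ext
  · simp [h]
  · have h2 := sub_mul_levelQuot ht 0
    rw [arc_im, h, sub_self, ← Real.sqrt_mul (endpt_pos t).le]
    rw [sub_zero, levelFun_zero] at h2
    simp [h2, crossing]

theorem arc_neg_sqrt (ht : 0 < t) : arc t (-√(endpt t)) = -(crossing t * Complex.I) := by
  rw [arc_neg, arc_sqrt ht]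
  simp

end

/-! ### The argument of `w` along the arc -/

/-- A branch of `log (w t v)`. -/
def logw (t : ℝ) (v : ℂ) : ℂ := Complex.log (v - 1) - Complex.log (v + 1) + t * v / 2

theorem exp_logw (t : ℝ) {v : ℂ} (h1 : v - 1 ∈ Complex.slitPlane)
    (h2 : v + 1 ∈ Complex.slitPlane) : Complex.exp (logw t v) = w t v := by
  rw [logw, Complex.exp_add, Complex.exp_sub, Complex.exp_log (Complex.slitPlane_ne_zero h1),
    Complex.exp_log (Complex.slitPlane_ne_zero h2), w]

theorem hasDerivAt_logw (t : ℝ) {v : ℂ} (h1 : v - 1 ∈ Complex.slitPlane)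
    (h2 : v + 1 ∈ Complex.slitPlane) :
    HasDerivAt (logw t) (1 / (v - 1) - 1 / (v + 1) + t / 2) v := by
  have d1 := ((hasDerivAt_id' v).sub_const 1).clog h1
  have d2 := ((hasDerivAt_id' v).add_const 1).clog h2
  have d3 := ((hasDerivAt_id' v).const_mul (t : ℂ)).div_const 2
  exact ((d1.fun_sub d2).fun_add d3).congr_deriv (by ring)

theorem logw_conj (t : ℝ) {v : ℂ} (h1 : v - 1 ∈ Complex.slitPlane)
    (h2 : v + 1 ∈ Complex.slitPlane) : logw t (conj v) = conj (logw t v) := by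
  have e1 := Complex.log_conj _ (Complex.slitPlane_arg_ne_pi h1)
  have e2 := Complex.log_conj _ (Complex.slitPlane_arg_ne_pi h2)
  simp only [map_sub, map_add, map_one] at e1 e2
  simp [logw, e1, e2, Complex.conj_ofNat]

/-- The arc meets the real axis only at `endpt t > 1`, so the principal logarithms of `v - 1` and `v
+ 1` are smooth along it. -/
theorem arc_slitPlane {t : ℝ} (ht : 0 < t) (ht4 : t < 4) {s : ℝ} (hs : s ^ 2 < 2 * endpt t)
    {a : ℝ} (ha : -1 ≤ a) : arc t s + a ∈ Complex.slitPlane := by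
  rw [Complex.mem_slitPlane_iff]
  rcases eq_or_ne s 0 with rfl | h
  · left
    have := one_lt_endpt t
    simp
    linarith
  · right
    have := (arc_im_eq_zero_iff ht ht4 hs).not.2 h
    rwa [Complex.add_im, Complex.ofReal_im, add_zero]

theorem arc_sub_one_slitPlane {t : ℝ} (ht : 0 < t) (ht4 : t < 4) {s : ℝ}
    (hs : s ^ 2 < 2 * endpt t) : arc t s - 1 ∈ Complex.slitPlane := by
  simpa [sub_eq_add_neg] using arc_slitPlane ht ht4 hs (le_refl (-1))

theorem arc_add_one_slitPlane {t : ℝ} (ht : 0 < t) (ht4 : t < 4) {s : ℝ}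
    (hs : s ^ 2 < 2 * endpt t) : arc t s + 1 ∈ Complex.slitPlane := by
  simpa using arc_slitPlane ht ht4 hs (a := 1) (by norm_num)

/-- The argument of `w` along the right arc. -/
def angle (t s : ℝ) : ℝ := (logw t (arc t s)).im

theorem norm_w_arc {t : ℝ} (ht : 0 < t) (ht4 : t < 4) {s : ℝ} (hs : s ^ 2 < 2 * endpt t) :
    ‖w t (arc t s)‖ = 1 :=
  (norm_w_eq_one_iff ht (ne_neg_one_of_mem_oval ht ht4 (arc_mem_oval ht ht4 hs))).2
    (Or.inr (arc_mem_oval ht ht4 hs))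

theorem logw_arc {t : ℝ} (ht : 0 < t) (ht4 : t < 4) {s : ℝ} (hs : s ^ 2 < 2 * endpt t) :
    logw t (arc t s) = angle t s * Complex.I := by
  have h := norm_w_arc ht ht4 hs
  rw [← exp_logw t (arc_sub_one_slitPlane ht ht4 hs) (arc_add_one_slitPlane ht ht4 hs),
    Complex.norm_exp, Real.exp_eq_one_iff] at h
  apply Complex.ext <;> simp [h, angle]

theorem w_arc {t : ℝ} (ht : 0 < t) (ht4 : t < 4) {s : ℝ} (hs : s ^ 2 < 2 * endpt t) :
    w t (arc t s) = Complex.exp (angle t s * Complex.I) := by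
  rw [← logw_arc ht ht4 hs,
    exp_logw t (arc_sub_one_slitPlane ht ht4 hs) (arc_add_one_slitPlane ht ht4 hs)]

theorem angle_neg {t : ℝ} (ht : 0 < t) (ht4 : t < 4) {s : ℝ} (hs : s ^ 2 < 2 * endpt t) :
    angle t (-s) = -angle t s := by
  rw [angle, arc_neg,
    logw_conj t (arc_sub_one_slitPlane ht ht4 hs) (arc_add_one_slitPlane ht ht4 hs),
    Complex.conj_im, angle]

theorem hasDerivAt_logw_arc {t : ℝ} (ht : 0 < t) (ht4 : t < 4) {s : ℝ}
    (hs : s ^ 2 < 2 * endpt t) :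
    HasDerivAt (fun s => logw t (arc t s))
      ((1 / (arc t s - 1) - 1 / (arc t s + 1) + t / 2) * deriv (arc t) s) s := by
  have := (hasDerivAt_logw t (arc_sub_one_slitPlane ht ht4 hs)
    (arc_add_one_slitPlane ht ht4 hs)).comp_of_eq s (hasDerivAt_arc ht ht4 hs) rfl
  exact this

theorem hasDerivAt_angle {t : ℝ} (ht : 0 < t) (ht4 : t < 4) {s : ℝ}
    (hs : s ^ 2 < 2 * endpt t) : HasDerivAt (angle t)
      ((1 / (arc t s - 1) - 1 / (arc t s + 1) + t / 2) * deriv (arc t) s).im s :=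
  Complex.imCLM.hasFDerivAt.comp_hasDerivAt s (hasDerivAt_logw_arc ht ht4 hs)

theorem eventually_sq_lt {t s : ℝ} (hs : s ^ 2 < 2 * endpt t) :
    ∀ᶠ r in 𝓝 s, r ^ 2 < 2 * endpt t :=
  (continuous_pow 2).continuousAt.eventually_lt continuousAt_const hs

theorem deriv_angle {t : ℝ} (ht : 0 < t) (ht4 : t < 4) {s : ℝ} (hs : s ^ 2 < 2 * endpt t) :
    ((deriv (angle t) s : ℝ) : ℂ) * Complex.I =
      (1 / (arc t s - 1) - 1 / (arc t s + 1) + t / 2) * deriv (arc t) s := by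
  have h1 := (hasDerivAt_angle ht ht4 hs)
  have h2 := (h1.differentiableAt.hasDerivAt.ofReal_comp).mul_const Complex.I
  refine h2.unique ((hasDerivAt_logw_arc ht ht4 hs).congr_of_eventuallyEq ?_)
  filter_upwards [eventually_sq_lt hs] with r hr
  exact (logw_arc ht ht4 hr).symm

/-- A critical point of `logw t` satisfies `v ^ 2 = 1 - 4 / t < 0`, hence is purely imaginary,
whereas `Re v > 0` on the open arc. -/
theorem deriv_angle_ne_zero {t : ℝ} (ht : 0 < t) (ht4 : t < 4) {s : ℝ} (hs : s ^ 2 < endpt t) :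
    deriv (angle t) s ≠ 0 := by
  have hs' : s ^ 2 < 2 * endpt t := by linarith [endpt_pos t]
  intro h
  have h1 := deriv_angle ht ht4 hs'
  rw [h, Complex.ofReal_zero, zero_mul, eq_comm, mul_eq_zero,
    or_iff_left (deriv_arc_ne_zero ht ht4 hs')] at h1
  have n1 := Complex.slitPlane_ne_zero (arc_sub_one_slitPlane ht ht4 hs')
  have n2 := Complex.slitPlane_ne_zero (arc_add_one_slitPlane ht ht4 hs')
  have hre : 0 < (arc t s).re := by rw [arc_re]; linarith
  set v := arc t s
  have h2 : 4 + (t : ℂ) * (v ^ 2 - 1) = 0 := by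
    field_simp at h1
    linear_combination h1
  have him := congrArg Complex.im h2
  have hr := congrArg Complex.re h2
  simp [pow_two] at him hr
  have h0 : v.im = 0 := by
    rcases him with h | h
    · exact absurd h ht.ne'
    · nlinarith
  rw [h0] at hr
  nlinarith [mul_pos ht (mul_pos hre hre)]

theorem deriv_angle_zero_pos {t : ℝ} (ht : 0 < t) (ht4 : t < 4) : 0 < deriv (angle t) 0 := by
  have hs : (0 : ℝ) ^ 2 < 2 * endpt t := by simpa using endpt_pos t
  have h := deriv_angle ht ht4 hs
  have hq := Real.sqrt_pos.2
    (levelQuot_pos ht ht4 (by linarith [endpt_pos t]) (le_refl (endpt t)))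
  have h1 := one_lt_endpt t
  have ha : arc t 0 = (endpt t : ℂ) := by simp [arc]
  rw [deriv_arc_zero ht ht4, ha, ← mul_assoc] at h
  have h2 := mul_right_cancel₀ Complex.I_ne_zero h
  have h3 : deriv (angle t) 0 =
      (1 / (endpt t - 1) - 1 / (endpt t + 1) + t / 2) * √(levelQuot t (endpt t)) := by
    exact_mod_cast h2
  rw [h3]
  refine mul_pos ?_ hq
  have : 1 / (endpt t + 1) < 1 / (endpt t - 1) :=
    one_div_lt_one_div_of_lt (by linarith) (by linarith)
  linarith

/-- By Darboux a derivative without zeros has constant sign on the interval; the sign is read off at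
the vertex. -/
theorem deriv_angle_pos {t : ℝ} (ht : 0 < t) (ht4 : t < 4) {s : ℝ} (hs : s ^ 2 < endpt t) :
    0 < deriv (angle t) s := by
  have hx := endpt_pos t
  have hd : ∀ s ∈ Ioo (-√(endpt t)) (√(endpt t)),
      HasDerivWithinAt (angle t) (deriv (angle t) s) (Ioo (-√(endpt t)) (√(endpt t))) s :=
    fun s hs => (hasDerivAt_angle ht ht4 (by
      linarith [sq_lt_iff_mem_Ioo.2 hs])).differentiableAt.hasDerivAt.hasDerivWithinAt
  rcases hasDerivWithinAt_forall_lt_or_forall_gt_of_forall_ne (convex_Ioo _ _) hd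
    (m := 0) (fun s hs => deriv_angle_ne_zero ht ht4 (sq_lt_iff_mem_Ioo.2 hs)) with h | h
  · have := h 0 (sq_lt_iff_mem_Ioo.1 (by simpa using hx))
    linarith [deriv_angle_zero_pos ht ht4]
  · exact h s (sq_lt_iff_mem_Ioo.1 hs)

theorem continuousOn_angle {t : ℝ} (ht : 0 < t) (ht4 : t < 4) :
    ContinuousOn (angle t) (Icc (-√(endpt t)) (√(endpt t))) := fun _ hs =>
  (hasDerivAt_angle ht ht4 (sq_lt_of_mem_Icc hs)).continuousAt.continuousWithinAt

theorem strictMonoOn_angle {t : ℝ} (ht : 0 < t) (ht4 : t < 4) :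
    StrictMonoOn (angle t) (Icc (-√(endpt t)) (√(endpt t))) := by
  apply strictMonoOn_of_deriv_pos (convex_Icc _ _) (continuousOn_angle ht ht4)
  intro s hs
  rw [interior_Icc] at hs
  exact deriv_angle_pos ht ht4 (sq_lt_iff_mem_Ioo.2 hs)

theorem arg_neg_one_add {c : ℝ} (hc : 0 < c) :
    Complex.arg (c * Complex.I - 1) = Real.pi - Complex.arg (c * Complex.I + 1) := by
  have h : (c * Complex.I - 1 : ℂ) = -conj (c * Complex.I + 1) := by
    simp
    ring
  rw [h, Complex.arg_neg_eq_arg_add_pi_of_im_neg (by simpa using hc), Complex.arg_conj, if_neg]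
  · ring
  · intro h
    have := Complex.arg_eq_pi_iff.1 h
    simp at this
    linarith

/-- For `u = 1 + i * crossing t`, `‖u‖ ^ 2 = 4 / t` gives `arccos (1 - t / 2) = π - 2 arg u`, which
is the contribution of the two logarithms; the term `t v / 2` gives the square root in `β`. -/
theorem angle_sqrt {t : ℝ} (ht : 0 < t) (ht4 : t < 4) : angle t (√(endpt t)) = β t := by
  have hc := crossing_pos ht ht4
  have hc2 := crossing_sq ht ht4
  have h1 : (↑t * (↑(crossing t) * Complex.I) / 2 : ℂ).im = t * crossing t / 2 := by
    rw [show (↑t * (↑(crossing t) * Complex.I) / 2 : ℂ)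
      = ((t * crossing t / 2 : ℝ) : ℂ) * Complex.I by push_cast; ring]
    simp
  have h2 : t * crossing t / 2 = 1 / 2 * √(t * (4 - t)) := by
    have : t * (4 - t) = (t * crossing t) ^ 2 := by
      rw [mul_pow, hc2]; field_simp
    rw [this, Real.sqrt_sq (by positivity)]
    ring
  have h3 : Real.arccos (1 - t / 2) = Real.pi - 2 * Complex.arg (crossing t * Complex.I + 1) := by
    set u : ℂ := crossing t * Complex.I + 1 with hu
    have hu0 : u ≠ 0 := by
      intro h
      have := congrArg Complex.re h
      simp [hu] at this
    have hn : ‖u‖ ^ 2 = 4 / t := by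
      rw [Complex.sq_norm, Complex.normSq_apply]
      simp [hu]
      linarith
    have hcos : Real.cos (Real.pi - 2 * u.arg) = 1 - t / 2 := by
      rw [Real.cos_pi_sub, Real.cos_two_mul, Complex.cos_arg hu0, div_pow, hn]
      simp [hu]
      ring
    have a1 : |u.arg| ≤ Real.pi / 2 := Complex.abs_arg_le_pi_div_two_iff.2 (by simp [hu])
    have a2 : 0 ≤ u.arg := Complex.arg_nonneg_iff.2 (by simpa [hu] using hc.le)
    rw [abs_le] at a1
    rw [← hcos, Real.arccos_cos] <;> linarith
  rw [angle, arc_sqrt ht, logw, Complex.add_im, Complex.sub_im, Complex.log_im, Complex.log_im,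
    arg_neg_one_add hc, h1, h2, β, h3]
  ring

theorem angle_neg_sqrt {t : ℝ} (ht : 0 < t) (ht4 : t < 4) : angle t (-√(endpt t)) = -β t := by
  rw [angle_neg ht ht4, angle_sqrt ht ht4]
  rw [Real.sq_sqrt (endpt_pos t).le]
  linarith [endpt_pos t]

theorem neg_sqrt_le_sqrt (t : ℝ) : -√(endpt t) ≤ √(endpt t) := by
  have := Real.sqrt_nonneg (endpt t)
  linarith

theorem β_pos {t : ℝ} (ht : 0 < t) (ht4 : t < 4) : 0 < β t := by
  have hs := Real.sqrt_pos.2 (endpt_pos t)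
  have := strictMonoOn_angle ht ht4 (left_mem_Icc.2 (neg_sqrt_le_sqrt t))
    (right_mem_Icc.2 (neg_sqrt_le_sqrt t)) (by linarith)
  rw [angle_sqrt ht ht4, angle_neg_sqrt ht ht4] at this
  linarith

/-- With `a = arccos (1 - t / 2)` one has `β t = a + sin a`, and `sin (π - a) < π - a`. -/
theorem β_lt_pi {t : ℝ} (ht4 : t < 4) : β t < Real.pi := by
  have h1 : 1 / 2 * √(t * (4 - t)) = Real.sin (Real.arccos (1 - t / 2)) := by
    rw [Real.sin_arccos, show t * (4 - t) = 2 ^ 2 * (1 - (1 - t / 2) ^ 2) by ring,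
      Real.sqrt_mul (by norm_num), Real.sqrt_sq (by norm_num)]
    ring
  have h2 : Real.arccos (1 - t / 2) < Real.pi := by
    refine lt_of_le_of_ne (Real.arccos_le_pi _) fun h => ?_
    have := Real.arccos_eq_pi.1 h
    linarith
  have h3 := Real.sin_lt (x := Real.pi - Real.arccos (1 - t / 2)) (by linarith)
  rw [Real.sin_pi_sub] at h3
  rw [β, h1]
  linarith

theorem image_angle {t : ℝ} (ht : 0 < t) (ht4 : t < 4) :
    angle t '' Icc (-√(endpt t)) (√(endpt t)) = Icc (-β t) (β t) := by
  have hle := neg_sqrt_le_sqrt t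
  apply Subset.antisymm
  · rintro _ ⟨s, hs, rfl⟩
    rw [← angle_neg_sqrt ht ht4, ← angle_sqrt ht ht4]
    have hm := (strictMonoOn_angle ht ht4).monotoneOn
    exact ⟨hm (left_mem_Icc.2 hle) hs hs.1, hm hs (right_mem_Icc.2 hle) hs.2⟩
  · rw [← angle_neg_sqrt ht ht4, ← angle_sqrt ht ht4]
    exact intermediate_value_Icc hle (continuousOn_angle ht ht4)

/-! ### The moments as residues -/

theorem exists_primitive {f : ℂ → ℂ} (hf : Differentiable ℂ f) (r : ℝ) :
    ∃ G : ℂ → ℂ, ∀ s ∈ Metric.ball (0 : ℂ) r, HasDerivAt G (f s) s :=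
  Complex.IsConservativeOn.isExactOn_ball hf.continuous.continuousOn
    (hf.differentiableOn (s := Metric.ball 0 r)).isConservativeOn

/-- The subtracted coefficient is the residue at `0`; once it is removed, a single-valued primitive
exists on the punctured disc. Integration by parts lowers the order of the pole, down to the entire
function `(exp (a s) - 1) / s`. -/
theorem exists_primitive_exp_div_pow (a : ℂ) (r : ℝ) (k : ℕ) :
    ∃ G : ℂ → ℂ, ∀ s ∈ Metric.ball (0 : ℂ) r, s ≠ 0 →
      HasDerivAt G (Complex.exp (a * s) / s ^ (k + 1) - a ^ k / k.factorial / s) s := by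
  induction k with
  | zero =>
    have hd : Differentiable ℂ (fun s => Complex.exp (a * s)) := by fun_prop
    have hd' : Differentiable ℂ (dslope (fun s => Complex.exp (a * s)) 0) := by
      rw [← differentiableOn_univ, Complex.differentiableOn_dslope univ_mem]
      exact hd.differentiableOn
    obtain ⟨G, hG⟩ := exists_primitive hd' r
    refine ⟨G, fun s hs h0 => (hG s hs).congr_deriv ?_⟩
    rw [dslope_of_ne _ h0, slope_def_field]
    simp
    ring
  | succ k ih =>
    obtain ⟨G, hG⟩ := ih
    refine ⟨fun s => (a * G s - Complex.exp (a * s) / s ^ (k + 1)) / (k + 1), fun s hs h0 => ?_⟩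
    have h1 : HasDerivAt (fun s => Complex.exp (a * s)) (Complex.exp (a * s) * (a * 1)) s :=
      ((hasDerivAt_id' s).const_mul a).cexp
    have h2 := h1.fun_div (hasDerivAt_pow (k + 1) s) (pow_ne_zero _ h0)
    have h3 := (((hG s hs h0).const_mul a).fun_sub h2).div_const ((k : ℂ) + 1)
    refine h3.congr_deriv ?_
    have hk : (k : ℂ) + 1 ≠ 0 := by exact_mod_cast k.succ_ne_zero
    have hf : (k.factorial : ℂ) ≠ 0 := by exact_mod_cast k.factorial_ne_zero
    rw [Nat.factorial_succ]
    push_cast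
    field_simp
    ring

theorem exists_primitive_one_add_inv_pow (a : ℂ) (r : ℝ) (n : ℕ) :
    ∃ G : ℂ → ℂ, ∀ s ∈ Metric.ball (0 : ℂ) r, s ≠ 0 →
      HasDerivAt G ((1 + s⁻¹) ^ n * Complex.exp (a * s) -
        (∑ k ∈ Finset.range n, (n.choose (k + 1) : ℂ) * (a ^ k / k.factorial)) / s) s := by
  choose G hG using exists_primitive_exp_div_pow a r
  obtain ⟨G₀, hG₀⟩ := exists_primitive (f := fun s => Complex.exp (a * s)) (by fun_prop) r
  refine ⟨fun s => G₀ s + ∑ k ∈ Finset.range n, (n.choose (k + 1) : ℂ) * G k s,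
    fun s hs h0 => ?_⟩
  refine ((hG₀ s hs).fun_add (HasDerivAt.fun_sum fun k _ =>
    (hG k s hs h0).const_mul (n.choose (k + 1) : ℂ))).congr_deriv ?_
  rw [add_comm 1 s⁻¹, add_pow, Finset.sum_range_succ', Finset.sum_div, add_mul,
    Finset.sum_mul, add_comm, add_sub_right_comm, ← Finset.sum_sub_distrib]
  congr 1
  · refine Finset.sum_congr rfl fun k _ => ?_
    simp only [one_pow, mul_one, inv_pow]
    ring
  · simp

theorem sum_choose_eq_moment (t : ℝ) {n : ℕ} (hn : 1 ≤ n) :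
    ∑ k ∈ Finset.range n, (n.choose (k + 1) : ℂ) * ((-(n * t) : ℂ) ^ k / k.factorial) =
      n * Complex.exp (n * t / 2) * (moment t n : ℂ) := by
  have hn0 : (n : ℂ) ≠ 0 := by exact_mod_cast (by omega : n ≠ 0)
  have he : Complex.exp (n * t / 2) * Complex.exp (-(n * t / 2)) = 1 := by
    rw [← Complex.exp_add]; simp
  rw [moment]
  push_cast
  rw [show ∀ A B C D : ℂ, A * B * (C * D) = A * (B * C) * D by intros; ring, he, mul_one,
    Finset.mul_sum]
  refine Finset.sum_congr rfl fun k _ => ?_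
  rw [zpow_sub_one₀ hn0, zpow_natCast, neg_mul_eq_mul_neg, mul_pow]
  field_simp

/-- The substitution `s = (v - 1) / 2` gives `w ^ (-n) = exp (-n t / 2) (1 + 1 / s) ^ n exp (-n t
s)`. Its residue at `v = 1` is `2 n m_n(t)`, the factor `2` coming from `dv = 2 ds`. -/
theorem exists_primitive_w_inv_pow (t r : ℝ) {n : ℕ} (hn : 1 ≤ n) :
    ∃ G : ℂ → ℂ, ∀ v : ℂ, ‖v‖ < r → v ≠ 1 →
      HasDerivAt G ((w t v)⁻¹ ^ n - 2 * n * moment t n / (v - 1)) v := by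
  obtain ⟨G, hG⟩ := exists_primitive_one_add_inv_pow (-(n * t)) ((r + 1) / 2) n
  refine ⟨fun v => 2 * Complex.exp (-(n * t / 2)) * G ((v - 1) / 2), fun v hv h1 => ?_⟩
  have h1' : v - 1 ≠ 0 := sub_ne_zero.2 h1
  have hb : (v - 1) / 2 ∈ Metric.ball (0 : ℂ) ((r + 1) / 2) := by
    rw [mem_ball_zero_iff, norm_div, Complex.norm_ofNat]
    have := norm_sub_le v 1
    rw [norm_one] at this
    linarith
  have h2 := (hG _ hb (div_ne_zero h1' two_ne_zero)).comp v
    (((hasDerivAt_id' v).sub_const 1).div_const 2)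
  refine (h2.const_mul (2 * Complex.exp (-(n * t / 2)))).congr_deriv ?_
  have he : Complex.exp (-(n * t / 2)) * Complex.exp (n * t / 2) = 1 := by
    rw [← Complex.exp_add]; simp
  have e1 : 1 + ((v - 1) / 2)⁻¹ = (v + 1) / (v - 1) := by
    field_simp
    ring
  have e2 : (w t v)⁻¹ ^ n = ((v + 1) / (v - 1)) ^ n *
      (Complex.exp (-(n * t / 2)) * Complex.exp (-(n * t) * ((v - 1) / 2))) := by
    rw [w, mul_inv, inv_div, mul_pow, ← Complex.exp_neg, ← Complex.exp_nat_mul, ← Complex.exp_add]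
    congr 2
    ring
  rw [e2, sum_choose_eq_moment t hn, e1]
  field_simp
  linear_combination (2 * n * moment t n : ℂ) * (-he)

/-! ### Mass and moment integrals along the arc -/

theorem continuousAt_deriv_arc {t : ℝ} (ht : 0 < t) (ht4 : t < 4) {s : ℝ}
    (hs : s ^ 2 < 2 * endpt t) : ContinuousAt (deriv (arc t)) s := by
  have h := (contDiffAt_arc ht ht4 hs).continuousAt_fderiv one_ne_zero
  have h2 : ContinuousAt (fun r => fderiv ℝ (arc t) r 1) s := h.clm_apply continuousAt_const
  exact h2

theorem continuousAt_deriv_angle {t : ℝ} (ht : 0 < t) (ht4 : t < 4) {s : ℝ}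
    (hs : s ^ 2 < 2 * endpt t) : ContinuousAt (deriv (angle t)) s := by
  have h1 := (hasDerivAt_arc ht ht4 hs).continuousAt
  have n1 := Complex.slitPlane_ne_zero (arc_sub_one_slitPlane ht ht4 hs)
  have n2 := Complex.slitPlane_ne_zero (arc_add_one_slitPlane ht ht4 hs)
  have h2 : ContinuousAt (fun s =>
      ((1 / (arc t s - 1) - 1 / (arc t s + 1) + t / 2) * deriv (arc t) s).im) s := by
    refine Complex.continuous_im.continuousAt.comp ?_
    refine ((((continuousAt_const.div (h1.sub continuousAt_const) n1).sub
      (continuousAt_const.div (h1.add continuousAt_const) n2)).add continuousAt_const).mul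
        (continuousAt_deriv_arc ht ht4 hs))
  refine h2.congr ?_
  filter_upwards [eventually_sq_lt hs] with r hr
  exact (hasDerivAt_angle ht ht4 hr).deriv.symm

theorem log_crossing {c : ℝ} (hc : 0 < c) :
    (Complex.log (c * Complex.I - 1)).im + (Complex.log (c * Complex.I + 1)).im = Real.pi := by
  rw [Complex.log_im, Complex.log_im, arg_neg_one_add hc]
  ring

theorem log_neg_crossing {c : ℝ} (hc : 0 < c) :
    (Complex.log (-(c * Complex.I) - 1)).im + (Complex.log (-(c * Complex.I) + 1)).im
      = -Real.pi := by
  have e1 : (-(c * Complex.I) - 1 : ℂ) = conj (c * Complex.I - 1) := by simp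
  have e2 : (-(c * Complex.I) + 1 : ℂ) = conj (c * Complex.I + 1) := by simp
  rw [e1, e2, Complex.log_conj, Complex.log_conj, Complex.conj_im, Complex.conj_im,
    ← log_crossing hc]
  · ring
  · refine Complex.slitPlane_arg_ne_pi (Complex.mem_slitPlane_iff.2 (Or.inr ?_))
    simpa using hc.ne'
  · refine Complex.slitPlane_arg_ne_pi (Complex.mem_slitPlane_iff.2 (Or.inr ?_))
    simpa using hc.ne'

/-- Multiplying the derivative of `log w = i θ` by `v` gives that of `log (v - 1) + log (v + 1) + t
v ^ 2 / 4`, whose imaginary part is thus a primitive. The quadratic term is real at both ends, and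
the logarithms contribute `π` and `-π`. -/
theorem integral_re_arc_mul_deriv_angle {t : ℝ} (ht : 0 < t) (ht4 : t < 4) :
    ∫ s in (-√(endpt t))..(√(endpt t)), (arc t s).re * deriv (angle t) s = 2 * Real.pi := by
  have hle := neg_sqrt_le_sqrt t
  have hderiv : ∀ s ∈ uIcc (-√(endpt t)) (√(endpt t)), HasDerivAt
      (fun s => (Complex.log (arc t s - 1) + Complex.log (arc t s + 1) + t * arc t s ^ 2 / 4).im)
      ((arc t s).re * deriv (angle t) s) s := by
    intro s hs
    rw [uIcc_of_le hle] at hs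
    have hs' := sq_lt_of_mem_Icc hs
    have ha := hasDerivAt_arc ht ht4 hs'
    have n1 := Complex.slitPlane_ne_zero (arc_sub_one_slitPlane ht ht4 hs')
    have n2 := Complex.slitPlane_ne_zero (arc_add_one_slitPlane ht ht4 hs')
    have d1 := (ha.sub_const 1).clog_real (arc_sub_one_slitPlane ht ht4 hs')
    have d2 := (ha.add_const 1).clog_real (arc_add_one_slitPlane ht ht4 hs')
    have d3 := ((ha.fun_pow 2).const_mul (t : ℂ)).div_const 4
    have d4 := (d1.fun_add d2).fun_add d3
    refine (Complex.imCLM.hasFDerivAt.comp_hasDerivAt s d4).congr_deriv ?_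
    have hd := deriv_angle ht ht4 hs'
    have e : deriv (arc t) s / (arc t s - 1) + deriv (arc t) s / (arc t s + 1) +
        t * ((2 : ℕ) * arc t s ^ (2 - 1) * deriv (arc t) s) / 4 =
        arc t s * ((deriv (angle t) s : ℝ) * Complex.I) := by
      rw [hd]
      push_cast
      field_simp
      ring
    rw [e]
    simp
  rw [intervalIntegral.integral_eq_sub_of_hasDerivAt hderiv]
  · have hc := crossing_pos ht ht4
    have h1 := log_crossing hc
    have h2 := log_neg_crossing hc
    have h3 : ((t : ℂ) * (crossing t * Complex.I) ^ 2 / 4).im = 0 := by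
      rw [mul_pow, Complex.I_sq, show (t : ℂ) * ((crossing t : ℂ) ^ 2 * -1) / 4
        = ((-(t * crossing t ^ 2 / 4) : ℝ) : ℂ) by push_cast; ring, Complex.ofReal_im]
    rw [arc_sqrt ht, arc_neg_sqrt ht, neg_sq]
    simp only [Complex.add_im, h3, h1, h2]
    ring
  · refine ContinuousOn.intervalIntegrable fun s hs => ContinuousAt.continuousWithinAt ?_
    rw [uIcc_of_le hle] at hs
    have hs' := sq_lt_of_mem_Icc hs
    exact (Complex.continuous_re.continuousAt.comp (hasDerivAt_arc ht ht4 hs').continuousAt).mul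
      (continuousAt_deriv_angle ht ht4 hs')

/-- Integration by parts leaves `sin (n θ) d(Re v)`, and `w ^ (-n) - w ^ n = -2 i sin (n θ)` on the
arc. Since `w ^ n` is `w ^ (-n)` at `-v`, one primitive `G` serves both powers, with logarithms for
the poles at `1` and `-1`. -/
theorem integral_cos_mul_re_arc_mul_deriv_angle {t : ℝ} (ht : 0 < t) (ht4 : t < 4) {n : ℕ}
    (hn : 1 ≤ n) :
    ∫ s in (-√(endpt t))..(√(endpt t)),
      Real.cos (n * angle t s) * (arc t s).re * deriv (angle t) s =
      2 * Real.pi * moment t n := by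
  have hn0 : (n : ℝ) ≠ 0 := by exact_mod_cast (by omega : n ≠ 0)
  have hle := neg_sqrt_le_sqrt t
  obtain ⟨r, hr⟩ : ∃ r, ∀ s ∈ Icc (-√(endpt t)) (√(endpt t)), ‖arc t s‖ < r := by
    have hc : ContinuousOn (fun s => ‖arc t s‖) (Icc (-√(endpt t)) (√(endpt t))) :=
      fun s hs =>
        (hasDerivAt_arc ht ht4 (sq_lt_of_mem_Icc hs)).continuousAt.norm.continuousWithinAt
    obtain ⟨M, hM⟩ := (isCompact_Icc.image_of_continuousOn hc).bddAbove
    exact ⟨M + 1, fun s hs => by linarith [hM (mem_image_of_mem _ hs)]⟩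
  obtain ⟨G, hG⟩ := exists_primitive_w_inv_pow t r hn
  set R : ℝ := 2 * n * moment t n with hR
  have hderiv : ∀ s ∈ uIcc (-√(endpt t)) (√(endpt t)), HasDerivAt
      (fun s => Real.sin (n * angle t s) * (arc t s).re / n +
        ((G (arc t s) + R * Complex.log (arc t s - 1)) +
          (G (-arc t s) + R * Complex.log (arc t s + 1))).im / (2 * n))
      (Real.cos (n * angle t s) * (arc t s).re * deriv (angle t) s) s := by
    intro s hs
    rw [uIcc_of_le hle] at hs
    have hs' := sq_lt_of_mem_Icc hs
    have ha := hasDerivAt_arc ht ht4 hs'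
    have n1 := Complex.slitPlane_ne_zero (arc_sub_one_slitPlane ht ht4 hs')
    have n2 := Complex.slitPlane_ne_zero (arc_add_one_slitPlane ht ht4 hs')
    have hG1 := (hG (arc t s) (hr s hs) (sub_ne_zero.1 n1)).comp_of_eq s ha rfl
    have hG2 := (hG (-arc t s) (by rw [norm_neg]; exact hr s hs)
      (fun h => n2 (by rw [← neg_neg (arc t s), h]; simp))).comp_of_eq s ha.fun_neg rfl
    have d1 := ((ha.sub_const 1).clog_real (arc_sub_one_slitPlane ht ht4 hs')).const_mul (R : ℂ)
    have d2 := ((ha.add_const 1).clog_real (arc_add_one_slitPlane ht ht4 hs')).const_mul (R : ℂ)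
    have d3 := (hG1.add d1).fun_add (hG2.add d2)
    have d4 := (Complex.imCLM.hasFDerivAt.comp_hasDerivAt s d3).div_const (2 * n : ℝ)
    have hang := (hasDerivAt_angle ht ht4 hs').differentiableAt.hasDerivAt
    have dre : HasDerivAt (fun s => (arc t s).re) (deriv (arc t) s).re s :=
      Complex.reCLM.hasFDerivAt.comp_hasDerivAt s ha
    have d5 := (((hang.const_mul (n : ℝ)).sin).fun_mul dre).div_const (n : ℝ)
    refine (d5.fun_add d4).congr_deriv ?_
    have e : ((w t (arc t s))⁻¹ ^ n - 2 * n * moment t n / (arc t s - 1)) * deriv (arc t) s +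
        R * (deriv (arc t) s / (arc t s - 1)) +
        (((w t (-arc t s))⁻¹ ^ n - 2 * n * moment t n / (-arc t s - 1)) * -deriv (arc t) s +
        R * (deriv (arc t) s / (arc t s + 1))) =
        ((w t (arc t s))⁻¹ ^ n - w t (arc t s) ^ n) * deriv (arc t) s := by
      rw [w_neg, inv_inv, hR]
      have n3 : -arc t s - 1 ≠ 0 := fun h => n2 (by linear_combination -h)
      have : (1 : ℂ) / (-arc t s - 1) = -(1 / (arc t s + 1)) := by
        field_simp
        ring
      push_cast
      rw [div_eq_mul_one_div _ (-arc t s - 1), this]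
      ring
    have e2 : (w t (arc t s))⁻¹ ^ n - w t (arc t s) ^ n =
        ((-2 * Real.sin (n * angle t s) : ℝ) : ℂ) * Complex.I := by
      rw [w_arc ht ht4 hs', ← Complex.exp_neg, ← Complex.exp_nat_mul, ← Complex.exp_nat_mul,
        mul_neg, ← mul_assoc, ← neg_mul, Complex.exp_mul_I, Complex.exp_mul_I, Complex.cos_neg,
        Complex.sin_neg]
      push_cast
      ring
    rw [e, e2, mul_assoc (Complex.ofReal _) Complex.I]
    simp only [Complex.imCLM_apply, Complex.im_ofReal_mul, Complex.I_mul_im]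
    field_simp
    ring
  rw [intervalIntegral.integral_eq_sub_of_hasDerivAt hderiv]
  · have hc := crossing_pos ht ht4
    have h1 := log_crossing hc
    have h2 := log_neg_crossing hc
    -- The endpoints are opposite to each other, so `G v + G (-v)` takes the same value at both and
    -- cancels; the sine term vanishes because `Re v = 0` there.
    rw [arc_sqrt ht, arc_neg_sqrt ht, neg_neg]
    simp only [Complex.add_im, Complex.im_ofReal_mul, Complex.neg_re]
    have h3 : ((crossing t : ℂ) * Complex.I).re = 0 := by simp
    rw [h3, hR]
    field_simp
    linear_combination (2 * n * moment t n) * (h1 - h2)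
  · refine ContinuousOn.intervalIntegrable fun s hs => ContinuousAt.continuousWithinAt ?_
    rw [uIcc_of_le hle] at hs
    have hs' := sq_lt_of_mem_Icc hs
    have hang := (hasDerivAt_angle ht ht4 hs').continuousAt
    exact ((Real.continuous_cos.continuousAt.comp (continuousAt_const.mul hang)).mul
      (Complex.continuous_re.continuousAt.comp (hasDerivAt_arc ht ht4 hs').continuousAt)).mul
      (continuousAt_deriv_angle ht ht4 hs')

/-! ### The density on the line -/

/-- `d` is the function carried by `[-β t, β t]` with `2 π d (angle t s) = Re (arc t s)`. -/
structure IsArcDensity (t : ℝ) (d : ℝ → ℝ) : Prop where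
  apply_angle : ∀ s ∈ Icc (-√(endpt t)) (√(endpt t)),
    d (angle t s) = (arc t s).re / (2 * Real.pi)
  eq_zero : ∀ θ, θ ∉ Icc (-β t) (β t) → d θ = 0

/-- By compactness `angle t` is a closed embedding of the parameter interval, so Tietze's theorem
applies. Continuity of the density then becomes a question about an indicator function. -/
theorem exists_extension_angle {t : ℝ} (ht : 0 < t) (ht4 : t < 4) : ∃ g : ℝ → ℝ,
    Continuous g ∧ ∀ s ∈ Icc (-√(endpt t)) (√(endpt t)), g (angle t s) = (arc t s).re := by
  have hc := (continuousOn_angle ht ht4).domRestrict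
  have hi := (strictMonoOn_angle ht ht4).injOn.injective
  have hr : Continuous fun s : Icc (-√(endpt t)) (√(endpt t)) => (arc t s).re := by
    simp only [arc_re]
    fun_prop
  obtain ⟨g, hg⟩ := ContinuousMap.exists_extension (hc.isClosedEmbedding hi) ⟨_, hr⟩
  exact ⟨g, g.continuous, fun s hs => congrArg (fun f => f ⟨s, hs⟩) hg⟩

theorem exists_angle_eq {t : ℝ} (ht : 0 < t) (ht4 : t < 4) {θ : ℝ}
    (hθ : θ ∈ Icc (-β t) (β t)) :
    ∃ s ∈ Icc (-√(endpt t)) (√(endpt t)), angle t s = θ := by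
  rwa [← image_angle ht ht4] at hθ

namespace IsArcDensity

variable {t : ℝ} {d : ℝ → ℝ}

theorem apply_β (ht : 0 < t) (ht4 : t < 4) (hd : IsArcDensity t d) : d (β t) = 0 := by
  rw [← angle_sqrt ht ht4, hd.apply_angle _ (right_mem_Icc.2 (neg_sqrt_le_sqrt t)), arc_sqrt ht]
  simp

theorem apply_neg_β (ht : 0 < t) (ht4 : t < 4) (hd : IsArcDensity t d) : d (-β t) = 0 := by
  rw [← angle_neg_sqrt ht ht4, hd.apply_angle _ (left_mem_Icc.2 (neg_sqrt_le_sqrt t)),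
    arc_neg_sqrt ht]
  simp

theorem continuous (ht : 0 < t) (ht4 : t < 4) (hd : IsArcDensity t d) : Continuous d := by
  obtain ⟨g, hgc, hg⟩ := exists_extension_angle ht ht4
  have hin : ∀ θ ∈ Icc (-β t) (β t), d θ = g θ / (2 * Real.pi) := by
    intro θ hθ
    obtain ⟨s, hs, rfl⟩ := exists_angle_eq ht ht4 hθ
    rw [hd.apply_angle s hs, hg s hs]
  have hβ := β_pos ht ht4
  have he : d = (Icc (-β t) (β t)).indicator (fun θ => g θ / (2 * Real.pi)) := by
    ext θ
    by_cases h : θ ∈ Icc (-β t) (β t)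
    · rw [indicator_of_mem h, hin θ h]
    · rw [indicator_of_notMem h, hd.eq_zero θ h]
  rw [he]
  -- Only `± β t` need checking; the density vanishes there because the arc ends on the imaginary
  -- axis.
  refine continuous_indicator ?_ (hgc.div_const _).continuousOn
  rw [frontier_Icc (by linarith)]
  rintro θ (rfl | rfl)
  · rw [← hin _ (left_mem_Icc.2 (by linarith)), hd.apply_neg_β ht ht4]
  · rw [← hin _ (right_mem_Icc.2 (by linarith)), hd.apply_β ht ht4]

theorem nonneg (ht : 0 < t) (ht4 : t < 4) (hd : IsArcDensity t d) (θ : ℝ) : 0 ≤ d θ := by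
  by_cases h : θ ∈ Icc (-β t) (β t)
  · obtain ⟨s, hs, rfl⟩ := exists_angle_eq ht ht4 h
    rw [hd.apply_angle s hs, arc_re]
    have := sq_le_iff_mem_Icc.2 hs
    exact div_nonneg (by linarith) (by positivity)
  · rw [hd.eq_zero θ h]

theorem pos (ht : 0 < t) (ht4 : t < 4) (hd : IsArcDensity t d) {θ : ℝ}
    (hθ : θ ∈ Ioo (-β t) (β t)) : 0 < d θ := by
  obtain ⟨s, hs, rfl⟩ := exists_angle_eq ht ht4 (Ioo_subset_Icc_self hθ)
  rw [hd.apply_angle s hs, arc_re]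
  have h : s ^ 2 < endpt t := by
    refine sq_lt_iff_mem_Ioo.2 ⟨hs.1.lt_of_ne ?_, hs.2.lt_of_ne ?_⟩
    · rintro rfl
      exact hθ.1.ne (angle_neg_sqrt ht ht4).symm
    · rintro rfl
      exact hθ.2.ne (angle_sqrt ht ht4)
  exact div_pos (by linarith) (by positivity)

theorem tsupport_eq (ht : 0 < t) (ht4 : t < 4) (hd : IsArcDensity t d) :
    tsupport d = Icc (-β t) (β t) := by
  have hβ := β_pos ht ht4
  refine Subset.antisymm (closure_minimal (fun θ hθ => ?_) isClosed_Icc) ?_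
  · by_contra h
    exact hθ (hd.eq_zero θ h)
  · rw [← closure_Ioo (by linarith : -β t ≠ β t)]
    exact closure_mono fun θ hθ => (hd.pos ht ht4 hθ).ne'

theorem hasCompactSupport (ht : 0 < t) (ht4 : t < 4) (hd : IsArcDensity t d) :
    HasCompactSupport d := by
  rw [HasCompactSupport, hd.tsupport_eq ht ht4]
  exact isCompact_Icc

theorem neg (ht : 0 < t) (ht4 : t < 4) (hd : IsArcDensity t d) (θ : ℝ) : d (-θ) = d θ := by
  by_cases h : θ ∈ Icc (-β t) (β t)
  · obtain ⟨s, hs, rfl⟩ := exists_angle_eq ht ht4 h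
    have hs' : -s ∈ Icc (-√(endpt t)) (√(endpt t)) := ⟨by linarith [hs.2], by linarith [hs.1]⟩
    rw [← angle_neg ht ht4 (sq_lt_of_mem_Icc hs), hd.apply_angle _ hs', hd.apply_angle _ hs]
    simp
  · rw [hd.eq_zero θ h, hd.eq_zero]
    intro h'
    exact h ⟨by linarith [h'.2], by linarith [h'.1]⟩

theorem integral_mul (ht : 0 < t) (ht4 : t < 4) (hd : IsArcDensity t d) {f : ℝ → ℝ}
    (hf : Continuous f) : ∫ θ, f θ * d θ =
      (∫ s in (-√(endpt t))..(√(endpt t)), f (angle t s) * (arc t s).re * deriv (angle t) s) /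
        (2 * Real.pi) := by
  have hβ := β_pos ht ht4
  have hle := neg_sqrt_le_sqrt t
  have h1 : ∫ θ, f θ * d θ = ∫ θ in (-β t)..(β t), f θ * d θ := by
    rw [intervalIntegral.integral_of_le (by linarith), ← integral_Icc_eq_integral_Ioc,
      setIntegral_eq_integral_of_forall_compl_eq_zero]
    intro θ hθ
    rw [hd.eq_zero θ hθ, mul_zero]
  have h2 := intervalIntegral.integral_comp_mul_deriv (a := -√(endpt t)) (b := √(endpt t))
    (f := angle t) (f' := deriv (angle t)) (g := fun θ => f θ * d θ)
    (fun s hs => by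
      rw [uIcc_of_le hle] at hs
      exact (hasDerivAt_angle ht ht4 (sq_lt_of_mem_Icc hs)).differentiableAt.hasDerivAt)
    (fun s hs => by
      rw [uIcc_of_le hle] at hs
      exact (continuousAt_deriv_angle ht ht4 (sq_lt_of_mem_Icc hs)).continuousWithinAt)
    (hf.mul (hd.continuous ht ht4))
  rw [angle_sqrt ht ht4, angle_neg_sqrt ht ht4] at h2
  rw [h1, ← h2, ← intervalIntegral.integral_div]
  refine intervalIntegral.integral_congr fun s hs => ?_
  rw [uIcc_of_le hle] at hs
  simp only [Function.comp_apply]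
  rw [hd.apply_angle s hs]
  ring

theorem integral_eq_one (ht : 0 < t) (ht4 : t < 4) (hd : IsArcDensity t d) : ∫ θ, d θ = 1 := by
  have h := hd.integral_mul ht ht4 (f := fun _ => 1) continuous_const
  simp only [one_mul] at h
  rw [h, integral_re_arc_mul_deriv_angle ht ht4, div_self Real.two_pi_pos.ne']

theorem integral_cos_mul (ht : 0 < t) (ht4 : t < 4) (hd : IsArcDensity t d) {n : ℕ}
    (hn : 1 ≤ n) : ∫ θ, Real.cos (n * θ) * d θ = moment t n := by
  rw [hd.integral_mul ht ht4 (f := fun θ => Real.cos (n * θ)) (by fun_prop),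
    integral_cos_mul_re_arc_mul_deriv_angle ht ht4 hn]
  field_simp

theorem integral_sin_mul (ht : 0 < t) (ht4 : t < 4) (hd : IsArcDensity t d) (n : ℕ) :
    ∫ θ, Real.sin (n * θ) * d θ = 0 := by
  have h := integral_neg_eq_self (fun θ => Real.sin (n * θ) * d θ) volume
  simp only [hd.neg ht ht4, mul_neg, Real.sin_neg, neg_mul, integral_neg] at h
  linarith

end IsArcDensity

/-! ### The measure on the circle -/

/-- The image of `d θ dθ` on the circle. -/
def circleMeasure (d : ℝ → ℝ) : Measure Circle :=
  ((volume : Measure ℝ).withDensity (fun θ => ENNReal.ofReal (d θ))).map Circle.exp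

theorem measurable_circleExp : Measurable (Circle.exp : ℝ → Circle) :=
  Circle.exp.continuous.measurable

theorem continuous_circle_coe : Continuous ((↑) : Circle → ℂ) := by fun_prop

theorem circleMeasure_apply {d : ℝ → ℝ} {s : Set Circle} (hs : MeasurableSet s) :
    circleMeasure d s = ∫⁻ θ in Circle.exp ⁻¹' s, ENNReal.ofReal (d θ) := by
  rw [circleMeasure, Measure.map_apply measurable_circleExp hs,
    withDensity_apply _ (measurable_circleExp hs)]

namespace IsArcDensity

variable {t : ℝ} {d : ℝ → ℝ}

theorem isSpectralMeasure (ht : 0 < t) (ht4 : t < 4) (hd : IsArcDensity t d) :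
    IsSpectralMeasure t (circleMeasure d) := by
  have hdc := hd.continuous ht ht4
  have hcs := hd.hasCompactSupport ht ht4
  constructor
  · constructor
    rw [circleMeasure_apply MeasurableSet.univ, preimage_univ, Measure.restrict_univ,
      ← ofReal_integral_eq_lintegral_ofReal (hdc.integrable_of_hasCompactSupport hcs)
        (Eventually.of_forall (hd.nonneg ht ht4)), hd.integral_eq_one ht ht4, ENNReal.ofReal_one]
  · intro n hn
    have hm : AEStronglyMeasurable (fun z : Circle => (z : ℂ) ^ n) (circleMeasure d) :=
      (by fun_prop : Continuous fun z : Circle => (z : ℂ) ^ n).aestronglyMeasurable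
    rw [circleMeasure, integral_map measurable_circleExp.aemeasurable hm,
      integral_withDensity_eq_integral_toReal_smul (by fun_prop)
        (Eventually.of_forall fun _ => ENNReal.ofReal_lt_top)]
    have he : ∀ θ : ℝ, (ENNReal.ofReal (d θ)).toReal • (Circle.exp θ : ℂ) ^ n =
        ((Real.cos (n * θ) * d θ : ℝ) : ℂ) + ((Real.sin (n * θ) * d θ : ℝ) : ℂ) * Complex.I := by
      intro θ
      rw [ENNReal.toReal_ofReal (hd.nonneg ht ht4 θ), Circle.coe_exp, ← Complex.exp_nat_mul,
        ← mul_assoc, Complex.exp_mul_I, Complex.real_smul]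
      push_cast
      ring
    simp_rw [he]
    have i1 : Integrable fun θ => Real.cos (n * θ) * d θ :=
      Continuous.integrable_of_hasCompactSupport (by fun_prop) hcs.mul_left
    have i2 : Integrable fun θ => Real.sin (n * θ) * d θ :=
      Continuous.integrable_of_hasCompactSupport (by fun_prop) hcs.mul_left
    rw [integral_add i1.ofReal (i2.ofReal.mul_const _), integral_mul_const, integral_complex_ofReal,
      integral_complex_ofReal, hd.integral_cos_mul ht ht4 hn, hd.integral_sin_mul ht ht4]
    simp

theorem support_circleMeasure (ht : 0 < t) (ht4 : t < 4) (hd : IsArcDensity t d) :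
    (circleMeasure d).support = Circle.exp '' Icc (-β t) (β t) := by
  have hβ := β_pos ht ht4
  have hdc := hd.continuous ht ht4
  have hclosed : IsClosed (Circle.exp '' Icc (-β t) (β t)) :=
    (isCompact_Icc.image Circle.exp.continuous).isClosed
  apply Subset.antisymm
  · refine Measure.support_subset_of_isClosed hclosed ?_
    rw [mem_ae_iff, circleMeasure_apply hclosed.measurableSet.compl]
    refine setLIntegral_eq_zero (measurable_circleExp hclosed.measurableSet.compl) fun θ hθ => ?_
    have : θ ∉ Icc (-β t) (β t) := fun h => hθ (mem_image_of_mem _ h)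
    simp [hd.eq_zero θ this]
  · rintro _ ⟨θ, hθ, rfl⟩
    rw [Measure.mem_support_iff_forall]
    intro U hU
    obtain ⟨V, hVU, hV, hθV⟩ := mem_nhds_iff.1 hU
    refine lt_of_lt_of_le ?_ (measure_mono hVU)
    have hO : IsOpen (Circle.exp ⁻¹' V ∩ Ioo (-β t) (β t)) :=
      (hV.preimage Circle.exp.continuous).inter isOpen_Ioo
    have hne : (Circle.exp ⁻¹' V ∩ Ioo (-β t) (β t)).Nonempty := by
      have : θ ∈ closure (Ioo (-β t) (β t)) := by rwa [closure_Ioo (by linarith)]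
      exact mem_closure_iff.1 this _ (hV.preimage Circle.exp.continuous) hθV
    rw [circleMeasure_apply hV.measurableSet, setLIntegral_pos_iff (by fun_prop)]
    refine lt_of_lt_of_le (hO.measure_pos volume hne) (measure_mono ?_)
    rintro φ ⟨h1, h2⟩
    exact ⟨by simpa using hd.pos ht ht4 h2, h1⟩

end IsArcDensity

/-- The image of Lebesgue measure on the circle is dominated by Haar measure. -/
theorem map_exp_volume_absolutelyContinuous :
    ((volume : Measure ℝ).restrict (Ioc (-Real.pi) Real.pi)).map Circle.exp ≪
      Measure.haarMeasure (⊤ : TopologicalSpace.PositiveCompacts Circle) := by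
  have : Fact (0 < 2 * Real.pi) := ⟨Real.two_pi_pos⟩
  set e : AddCircle (2 * Real.pi) ≃ₜ Circle := AddCircle.homeomorphCircle' with he
  have hem : Measurable e := e.continuous.measurable
  set ν : Measure Circle := (volume : Measure (AddCircle (2 * Real.pi))).map e with hν
  have h1 : ((volume : Measure ℝ).restrict (Ioc (-Real.pi) Real.pi)).map Circle.exp = ν := by
    have hp := (AddCircle.measurePreserving_mk (2 * Real.pi) (-Real.pi)).map_eq
    rw [show -Real.pi + 2 * Real.pi = Real.pi by ring] at hp
    rw [hν, ← hp, Measure.map_map hem AddCircle.measurable_mk']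
    rfl
  -- The homeomorphism turns addition into multiplication, so `ν` inherits translation invariance,
  -- and uniqueness of Haar measure applies.
  have h2 : ν.IsMulLeftInvariant := by
    constructor
    intro g
    obtain ⟨a, rfl⟩ := e.surjective g
    rw [hν, Measure.map_map (measurable_const_mul _) hem]
    have hc : (fun x => e a * x) ∘ e = e ∘ fun x => a + x := by
      ext x
      induction a using QuotientAddGroup.induction_on
      induction x using QuotientAddGroup.induction_on
      simp only [Function.comp_apply, ← QuotientAddGroup.mk_add]
      simp only [he, AddCircle.homeomorphCircle'_apply_mk, Circle.exp_add]
    rw [hc, ← Measure.map_map hem (measurable_const_add a), map_add_left_eq_self]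
  have h3 : IsFiniteMeasure ν := Measure.isFiniteMeasure_map _ _
  rw [h1, Measure.isMulInvariant_eq_smul_of_compactSpace ν
    (Measure.haarMeasure (⊤ : TopologicalSpace.PositiveCompacts Circle))]
  exact Measure.AbsolutelyContinuous.rfl.smul_left _

theorem IsArcDensity.absolutelyContinuous {t : ℝ} {d : ℝ → ℝ} (ht4 : t < 4)
    (hd : IsArcDensity t d) : circleMeasure d ≪
      Measure.haarMeasure (⊤ : TopologicalSpace.PositiveCompacts Circle) := by
  refine Measure.AbsolutelyContinuous.trans ?_ map_exp_volume_absolutelyContinuous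
  refine Measure.AbsolutelyContinuous.map ?_ measurable_circleExp
  -- As `β t < π`, the density lives on a single period.
  have h1 : (fun θ => ENNReal.ofReal (d θ)) =
      (Ioc (-Real.pi) Real.pi).indicator fun θ => ENNReal.ofReal (d θ) := by
    ext θ
    by_cases h : θ ∈ Ioc (-Real.pi) Real.pi
    · rw [indicator_of_mem h]
    · rw [indicator_of_notMem h, hd.eq_zero θ, ENNReal.ofReal_zero]
      have := β_lt_pi ht4
      exact fun h' => h ⟨by linarith [h'.1], by linarith [h'.2]⟩
  rw [h1, withDensity_indicator measurableSet_Ioc]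
  exact withDensity_absolutelyContinuous _ _

/-! ### Uniqueness of the spectral measure -/

/-- A finite measure on the circle is determined by its Fourier coefficients. -/
theorem measure_circle_ext {μ ν : Measure Circle} [IsFiniteMeasure μ] [IsFiniteMeasure ν]
    (h : ∀ n : ℤ, ∫ z : Circle, (z : ℂ) ^ n ∂μ = ∫ z : Circle, (z : ℂ) ^ n ∂ν) : μ = ν := by
  let e : ℤ → BoundedContinuousFunction Circle ℂ := fun n =>
    BoundedContinuousFunction.mkOfCompact ⟨fun z => ((z ^ n : Circle) : ℂ),
      continuous_circle_coe.comp (continuous_zpow n)⟩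
  -- Characters are closed under products, so the algebra they generate is their linear span, and
  -- comparing integrals of characters suffices.
  have hadj : Submodule.span ℂ (range e) =
      Subalgebra.toSubmodule (Algebra.adjoin ℂ (range e)) := by
    symm
    apply Algebra.adjoin_eq_span_of_subset
    refine Subset.trans ?_ Submodule.subset_span
    intro x hx
    refine Submonoid.closure_induction (fun _ => id) ⟨0, ?_⟩ ?_ hx
    · ext z
      simp [e]
    · rintro - - - - ⟨m, rfl⟩ ⟨n, rfl⟩
      refine ⟨m + n, ?_⟩
      ext z
      simp [e, zpow_add₀ (Circle.coe_ne_zero z)]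
  let A : StarSubalgebra ℂ (BoundedContinuousFunction Circle ℂ) :=
    { toSubalgebra := Algebra.adjoin ℂ (range e)
      star_mem' := by
        change Algebra.adjoin ℂ (range e) ≤ star (Algebra.adjoin ℂ (range e))
        refine Algebra.adjoin_le ?_
        rintro - ⟨n, rfl⟩
        refine Algebra.subset_adjoin ⟨-n, ?_⟩
        ext z
        simp [e, ← Circle.coe_inv_eq_conj] }
  refine ext_of_forall_mem_subalgebra_integral_eq_of_polish (𝕜 := ℂ) (A := A) ?_ ?_
  · intro x y hxy
    refine ⟨_, ⟨_, ⟨e 1, Algebra.subset_adjoin ⟨1, rfl⟩, rfl⟩, rfl⟩, ?_⟩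
    simpa [e, Circle.ext_iff] using hxy
  · intro g hg
    have hg' : g ∈ Submodule.span ℂ (range e) := by rw [hadj]; exact hg
    clear hg
    induction hg' using Submodule.span_induction with
    | mem x hx =>
      obtain ⟨n, rfl⟩ := hx
      simpa [e] using h n
    | zero => simp
    | add x y _ _ hx hy =>
      simp only [BoundedContinuousFunction.coe_add, Pi.add_apply]
      rw [integral_add (x.integrable μ) (y.integrable μ),
        integral_add (x.integrable ν) (y.integrable ν), hx, hy]
    | smul a x _ hx =>
      simp only [BoundedContinuousFunction.coe_smul]
      rw [integral_smul, integral_smul, hx]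

theorem IsSpectralMeasure.unique {t : ℝ} {μ ν : Measure Circle} (hμ : IsSpectralMeasure t μ)
    (hν : IsSpectralMeasure t ν) : μ = ν := by
  have := hμ.isProbabilityMeasure
  have := hν.isProbabilityMeasure
  have hnat : ∀ n : ℕ, ∫ z : Circle, (z : ℂ) ^ n ∂μ = ∫ z : Circle, (z : ℂ) ^ n ∂ν := by
    intro n
    rcases Nat.eq_zero_or_pos n with rfl | hn
    · simp
    · rw [hμ.integral_pow n hn, hν.integral_pow n hn]
  apply measure_circle_ext
  intro n
  obtain ⟨m, rfl | rfl⟩ := n.eq_nat_or_neg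
  · simpa using hnat m
  · have hz : ∀ z : Circle, (z : ℂ) ^ (-(m : ℤ)) = conj ((z : ℂ) ^ m) := by
      intro z
      rw [zpow_neg, zpow_natCast, map_pow, ← Circle.coe_inv_eq_conj, Circle.coe_inv, inv_pow]
    simp_rw [hz]
    rw [integral_conj, integral_conj, hnat]

/-! ### Existence of the curve -/

/-- The curve `γ_t`, the image of the oval under `v ↦ 2 / (v + 1)`. -/
def curveSet (t : ℝ) : Set ℂ := {z | z ≠ 0 ∧ 2 / z - 1 ∈ oval t}

theorem two_div_mem_curveSet {t : ℝ} {v : ℂ} (hv : v ≠ -1) :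
    2 / (v + 1) ∈ curveSet t ↔ v ∈ oval t := by
  have h1 : v + 1 ≠ 0 := fun h => hv (eq_neg_of_add_eq_zero_left h)
  have h2 : 2 / (2 / (v + 1)) - 1 = v := by
    field_simp
    ring
  rw [curveSet, mem_ofPred_eq, h2, and_iff_right (div_ne_zero two_ne_zero h1)]

theorem two_div_injOn : InjOn (fun v : ℂ => 2 / (v + 1)) {v | v ≠ -1} := by
  intro v hv u hu h
  have h1 : v + 1 ≠ 0 := fun h => hv (eq_neg_of_add_eq_zero_left h)
  have h2 : u + 1 ≠ 0 := fun h => hu (eq_neg_of_add_eq_zero_left h)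
  simp only at h
  rw [div_eq_div_iff h1 h2] at h
  linear_combination -h / 2

theorem curveSet_eq_image {t : ℝ} (ht : 0 < t) (ht4 : t < 4) :
    curveSet t = (fun v : ℂ => 2 / (v + 1)) '' oval t := by
  ext z
  constructor
  · rintro ⟨h0, hz⟩
    refine ⟨_, hz, ?_⟩
    field_simp
    simp
  · rintro ⟨v, hv, rfl⟩
    exact (two_div_mem_curveSet (ne_neg_one_of_mem_oval ht ht4 hv)).2 hv

theorem norm_h_of_mem_curveSet {t : ℝ} (ht : 0 < t) {z : ℂ} (hz : z ∈ curveSet t) :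
    ‖h t z‖ = 1 := by
  rw [h_eq_w t hz.1, norm_w_eq_one_iff ht]
  · exact Or.inr hz.2
  · intro h
    have : 2 / z = 0 := by linear_combination h
    simp [hz.1] at this

theorem abs_two_div_sub_one_le {x : ℝ} (hx : 1 ≤ x) : |2 / x - 1| ≤ 1 := by
  rw [abs_le]
  constructor
  · have : 0 < 2 / x := by positivity
    linarith
  · have : 2 / x ≤ 2 := by rw [div_le_iff₀ (by linarith)]; linarith
    linarith

theorem curveSet_disjoint {t : ℝ} (ht : 0 < t) (ht4 : t < 4) :
    Disjoint (curveSet t) (Complex.ofReal '' Ici 1) := by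
  rw [Set.disjoint_left]
  rintro _ hz ⟨x, hx, rfl⟩
  refine ofReal_notMem_oval ht ht4 (abs_two_div_sub_one_le hx) ?_
  simpa using hz.2

theorem exists_levelFun_lt {t : ℝ} (ht : 0 < t) (ht4 : t < 4) :
    ∃ B : ℝ, 0 < B ∧ ∀ v : ℂ, B < ‖v‖ → levelFun t v.re < v.im ^ 2 := by
  obtain ⟨M, hM⟩ := (isCompact_Icc (a := -endpt t) (b := endpt t)).bddAbove_image
    (continuous_levelFun ht).continuousOn
  have hx := endpt_pos t
  refine ⟨endpt t + (|M| + 1), by positivity, fun v hv => ?_⟩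
  by_contra! hle
  have h1 : |v.re| ≤ endpt t := (levelFun_nonneg_iff ht ht4).1 ((sq_nonneg _).trans hle)
  have h2 : v.im ^ 2 ≤ |M| :=
    (hle.trans (hM (mem_image_of_mem _ (abs_le.1 h1)))).trans (le_abs_self M)
  have h3 : |v.im| ≤ |M| + 1 := by
    rw [← sq_abs] at h2
    nlinarith [abs_nonneg v.im]
  have := Complex.norm_le_abs_re_add_abs_im v
  linarith

/-- In the coordinate `v`, `U` is the inside of the oval and `V` its outside with `v = ∞` (`z = 0`)
added; both are open, so the component of `0` stays in `V`. The point `v = -1`, which is `z = ∞`, is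
interior to the oval, hence `V` is bounded. -/
theorem encircles_curveSet {t : ℝ} (ht : 0 < t) (ht4 : t < 4) : Encircles (curveSet t) 0 := by
  have h0 : (0 : ℂ) ∉ curveSet t := fun h => h.1 rfl
  refine ⟨h0, ?_⟩
  have hF := continuous_levelFun ht
  set U : Set ℂ := {z | z ≠ 0 ∧ (2 / z - 1).im ^ 2 < levelFun t (2 / z - 1).re} with hU
  set V : Set ℂ := {z | z = 0 ∨ levelFun t (2 / z - 1).re < (2 / z - 1).im ^ 2} with hV
  have hc : ∀ z : ℂ, z ≠ 0 → ContinuousAt (fun z : ℂ => 2 / z - 1) z := fun z hz =>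
    (continuousAt_const.div continuousAt_id hz).sub continuousAt_const
  have hc1 : ∀ z : ℂ, z ≠ 0 → ContinuousAt (fun z : ℂ => (2 / z - 1).im ^ 2) z := fun z hz =>
    (Complex.continuous_im.continuousAt.comp (hc z hz)).pow 2
  have hc2 : ∀ z : ℂ, z ≠ 0 → ContinuousAt (fun z : ℂ => levelFun t (2 / z - 1).re) z :=
    fun z hz => hF.continuousAt.comp (f := fun z : ℂ => (2 / z - 1).re)
      (Complex.continuous_re.continuousAt.comp (hc z hz))
  have hUo : IsOpen U := by
    rw [isOpen_iff_mem_nhds]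
    rintro z ⟨hz, hlt⟩
    filter_upwards [isOpen_ne.mem_nhds hz, (hc1 z hz).eventually_lt (hc2 z hz) hlt] with y h1 h2
    exact ⟨h1, h2⟩
  have hVo : IsOpen V := by
    rw [isOpen_iff_mem_nhds]
    intro z hz
    rcases eq_or_ne z 0 with rfl | hz0
    · obtain ⟨B, hB, hlt⟩ := exists_levelFun_lt ht ht4
      have hpos : 0 < 2 / (B + 1) := by positivity
      filter_upwards [Metric.ball_mem_nhds (0 : ℂ) hpos] with y hy
      rcases eq_or_ne y 0 with rfl | hy0
      · exact Or.inl rfl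
      · refine Or.inr (hlt _ ?_)
        rw [mem_ball_zero_iff, lt_div_iff₀ (by linarith)] at hy
        have h1 := norm_sub_norm_le (2 / y) 1
        have h2 : B + 1 < ‖2 / y‖ := by
          rw [norm_div, Complex.norm_ofNat, lt_div_iff₀ (norm_pos_iff.2 hy0)]
          linarith
        rw [norm_one] at h1
        linarith
    · have hlt := hz.resolve_left hz0
      filter_upwards [(hc2 z hz0).eventually_lt (hc1 z hz0) hlt] with y h1
      exact Or.inr h1
  have hUV : Disjoint U V := by
    rw [Set.disjoint_left]
    rintro z ⟨h1, h2⟩ (h3 | h3)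
    · exact h1 h3
    · exact lt_asymm h2 h3
  have hcover : (curveSet t)ᶜ ⊆ U ∪ V := by
    intro z hz
    rcases eq_or_ne z 0 with rfl | hz0
    · exact Or.inr (Or.inl rfl)
    · rcases lt_trichotomy ((2 / z - 1).im ^ 2) (levelFun t (2 / z - 1).re) with h | h | h
      · exact Or.inl ⟨hz0, h⟩
      · exact absurd ⟨hz0, h⟩ hz
      · exact Or.inr (Or.inr h)
  have hsub : connectedComponentIn (curveSet t)ᶜ 0 ⊆ V :=
    isPreconnected_connectedComponentIn.subset_right_of_subset_union hUo hVo hUV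
      ((connectedComponentIn_subset _ _).trans hcover)
      ⟨0, mem_connectedComponentIn h0, Or.inl rfl⟩
  refine Bornology.IsBounded.subset ?_ hsub
  have hin : ∀ᶠ v : ℂ in 𝓝 (-1), v.im ^ 2 < levelFun t v.re := by
    refine ContinuousAt.eventually_lt (by fun_prop)
      (hF.comp Complex.continuous_re).continuousAt ?_
    have := (levelFun_pos_iff ht ht4 (x := -1)).2 (by simpa using one_lt_endpt t)
    simpa using this
  obtain ⟨δ, hδ, hball⟩ := Metric.eventually_nhds_iff_ball.1 hin
  refine (Metric.isBounded_closedBall (x := (0 : ℂ)) (r := 2 / δ)).subset fun z hz => ?_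
  rw [mem_closedBall_zero_iff]
  rcases eq_or_ne z 0 with rfl | hz0
  · rw [norm_zero]; positivity
  · by_contra! hlt
    refine lt_asymm (hz.resolve_left hz0) (hball _ ?_)
    rw [mem_ball_iff_norm, sub_neg_eq_add, sub_add_cancel, norm_div, Complex.norm_ofNat,
      div_lt_iff₀ (norm_pos_iff.2 hz0)]
    rw [div_lt_iff₀ hδ] at hlt
    linarith

/-- The left half of the oval. -/
theorem image_neg_conj_arc {t : ℝ} (ht : 0 < t) (ht4 : t < 4) :
    (fun s => -conj (arc t s)) '' Icc (-√(endpt t)) (√(endpt t)) =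
      {v ∈ oval t | v.re ≤ 0} := by
  have h := image_arc ht ht4
  rw [Set.ext_iff] at h
  ext v
  have := h (-conj v)
  constructor
  · rintro ⟨s, hs, rfl⟩
    have := (h (arc t s)).1 ⟨s, hs, rfl⟩
    exact ⟨neg_mem_oval (conj_mem_oval this.1), by simpa using this.2⟩
  · rintro ⟨hv, h0⟩
    obtain ⟨s, hs, hsv⟩ := this.2 ⟨neg_mem_oval (conj_mem_oval hv), by simpa using h0⟩
    exact ⟨s, hs, by simp [hsv]⟩

theorem contDiffAt_two_div {g : ℝ → ℂ} {τ : ℝ} (hg : ContDiffAt ℝ 1 g τ) (h1 : g τ ≠ -1) :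
    ContDiffAt ℝ 1 (fun τ => 2 / (g τ + 1)) τ := by
  simp only [div_eq_mul_inv]
  exact contDiffAt_const.mul ((hg.add contDiffAt_const).inv
    (fun h => h1 (eq_neg_of_add_eq_zero_left h)))

theorem deriv_two_div_ne_zero {g : ℝ → ℂ} {g' : ℂ} {τ : ℝ} (hg : HasDerivAt g g' τ)
    (h1 : g τ ≠ -1) (h0 : g' ≠ 0) : deriv (fun τ => 2 / (g τ + 1)) τ ≠ 0 := by
  have h2 : g τ + 1 ≠ 0 := fun h => h1 (eq_neg_of_add_eq_zero_left h)
  rw [((hasDerivAt_const τ (2 : ℂ)).fun_div (hg.add_const 1) h2).deriv]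
  have : (0 * (g τ + 1) - 2 * g') / (g τ + 1) ^ 2 = -2 * g' / (g τ + 1) ^ 2 := by ring
  rw [this]
  exact div_ne_zero (mul_ne_zero (by norm_num) h0) (pow_ne_zero _ h2)

theorem isPiecewiseSmoothJordanCurve_curveSet {t : ℝ} (ht : 0 < t) (ht4 : t < 4) :
    IsPiecewiseSmoothJordanCurve (curveSet t) := by
  have hS : 0 < √(endpt t) := Real.sqrt_pos.2 (endpt_pos t)
  set S := √(endpt t) with hSdef
  -- On `[0, 1/2]` the right half runs from the lower to the upper crossing point; on `[1/2, 1]` its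
  -- mirror image runs back.
  set g₁ : ℝ → ℂ := fun τ => arc t ((4 * τ - 1) * S) with hg₁
  set g₂ : ℝ → ℂ := fun τ => -conj (arc t ((3 - 4 * τ) * S)) with hg₂
  set ℓ : ℝ → ℂ := fun τ => if τ ≤ 1 / 2 then g₁ τ else g₂ τ with hℓ
  have m₁ : ∀ τ ∈ Icc (0 : ℝ) (1 / 2), (4 * τ - 1) * S ∈ Icc (-S) S := fun τ hτ =>
    ⟨by nlinarith [hτ.1], by nlinarith [hτ.2]⟩
  have m₂ : ∀ τ ∈ Icc (1 / 2 : ℝ) 1, (3 - 4 * τ) * S ∈ Icc (-S) S := fun τ hτ =>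
    ⟨by nlinarith [hτ.2], by nlinarith [hτ.1]⟩
  have hmid : g₁ (1 / 2) = g₂ (1 / 2) := by
    simp only [hg₁, hg₂]
    norm_num
    rw [hSdef, arc_sqrt ht]
    simp
  have hℓ₁ : ∀ τ ∈ Icc (0 : ℝ) (1 / 2), ℓ τ = g₁ τ := fun τ hτ => if_pos hτ.2
  have hℓ₂ : ∀ τ ∈ Icc (1 / 2 : ℝ) 1, ℓ τ = g₂ τ := by
    intro τ hτ
    rcases hτ.1.eq_or_lt with h | h
    · rw [← h, hℓ₁ _ ⟨by norm_num, le_rfl⟩, hmid]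
    · exact if_neg (not_le.2 h)
  have d₁ : ∀ τ ∈ Icc (0 : ℝ) (1 / 2), ContDiffAt ℝ 1 g₁ τ ∧ ∃ g', HasDerivAt g₁ g' τ ∧ g' ≠ 0 := by
    intro τ hτ
    have hs := sq_lt_of_mem_Icc (m₁ τ hτ)
    have haff : ContDiff ℝ 1 fun τ : ℝ => (4 * τ - 1) * S := by fun_prop
    have h1 := HasDerivAt.scomp (g₁ := arc t) (h := fun τ : ℝ => (4 * τ - 1) * S) τ
      (hasDerivAt_arc ht ht4 hs) ((((hasDerivAt_id' τ).const_mul 4).sub_const 1).mul_const S)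
    refine ⟨ContDiffAt.comp (g := arc t) τ (contDiffAt_arc ht ht4 hs) haff.contDiffAt, _, h1, ?_⟩
    exact smul_ne_zero (by positivity) (deriv_arc_ne_zero ht ht4 hs)
  have d₂ : ∀ τ ∈ Icc (1 / 2 : ℝ) 1, ContDiffAt ℝ 1 g₂ τ ∧ ∃ g', HasDerivAt g₂ g' τ ∧ g' ≠ 0 := by
    intro τ hτ
    have hs := sq_lt_of_mem_Icc (m₂ τ hτ)
    have haff : ContDiff ℝ 1 fun τ : ℝ => (3 - 4 * τ) * S := by fun_prop
    have h1 := HasDerivAt.scomp (g₁ := arc t) (h := fun τ : ℝ => (3 - 4 * τ) * S) τ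
      (hasDerivAt_arc ht ht4 hs) ((((hasDerivAt_id' τ).const_mul 4).const_sub 3).mul_const S)
    refine ⟨(Complex.conjCLE.contDiff.contDiffAt.comp τ
      (ContDiffAt.comp (g := arc t) τ (contDiffAt_arc ht ht4 hs) haff.contDiffAt)).neg, _,
      (Complex.conjCLE.hasFDerivAt.comp_hasDerivAt τ h1).neg, ?_⟩
    refine neg_ne_zero.2 ?_
    simp [deriv_arc_ne_zero ht ht4 hs, hS.ne']
  have im₁ : ℓ '' Icc 0 (1 / 2) = {v ∈ oval t | 0 ≤ v.re} := by
    rw [image_congr hℓ₁, ← image_arc ht ht4, ← hSdef]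
    ext v
    constructor
    · rintro ⟨τ, hτ, rfl⟩
      exact ⟨_, m₁ τ hτ, rfl⟩
    · rintro ⟨s, hs, rfl⟩
      refine ⟨(s / S + 1) / 4, ⟨?_, ?_⟩, ?_⟩
      · have : -1 ≤ s / S := by rw [le_div_iff₀ hS]; linarith [hs.1]
        linarith
      · have : s / S ≤ 1 := by rw [div_le_iff₀ hS]; linarith [hs.2]
        linarith
      · simp only [hg₁]
        congr 1
        field_simp
        ring
  have im₂ : ℓ '' Icc (1 / 2) 1 = {v ∈ oval t | v.re ≤ 0} := by
    rw [image_congr hℓ₂, ← image_neg_conj_arc ht ht4, ← hSdef]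
    ext v
    constructor
    · rintro ⟨τ, hτ, rfl⟩
      exact ⟨_, m₂ τ hτ, rfl⟩
    · rintro ⟨s, hs, rfl⟩
      refine ⟨(3 - s / S) / 4, ⟨?_, ?_⟩, ?_⟩
      · have : s / S ≤ 1 := by rw [div_le_iff₀ hS]; linarith [hs.2]
        linarith
      · have : -1 ≤ s / S := by rw [le_div_iff₀ hS]; linarith [hs.1]
        linarith
      · simp only [hg₂]
        congr 3
        field_simp
        ring
  have hsplit : Icc (0 : ℝ) 1 = Icc 0 (1 / 2) ∪ Icc (1 / 2) 1 :=
    (Icc_union_Icc_eq_Icc (by norm_num) (by norm_num)).symm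
  have him : ℓ '' Icc 0 1 = oval t := by
    rw [hsplit, image_union, im₁, im₂]
    ext v
    constructor
    · rintro (h | h) <;> exact h.1
    · intro h
      rcases le_total 0 v.re with h0 | h0
      · exact Or.inl ⟨h, h0⟩
      · exact Or.inr ⟨h, h0⟩
  have hne : ∀ τ ∈ Icc (0 : ℝ) 1, ℓ τ ≠ -1 := fun τ hτ =>
    ne_neg_one_of_mem_oval ht ht4 (him ▸ mem_image_of_mem ℓ hτ)
  -- Strictness means that the two halves share only the crossing points.
  have hre : ∀ τ ∈ Ioo (1 / 2 : ℝ) 1, (ℓ τ).re < 0 := by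
    intro τ hτ
    rw [hℓ₂ τ (Ioo_subset_Icc_self hτ)]
    simp only [hg₂, Complex.neg_re, Complex.conj_re, arc_re]
    have : ((3 - 4 * τ) * S) ^ 2 < endpt t :=
      sq_lt_iff_mem_Ioo.2 ⟨by nlinarith [hτ.2], by nlinarith [hτ.1]⟩
    linarith
  have hre' : ∀ τ ∈ Icc (0 : ℝ) (1 / 2), 0 ≤ (ℓ τ).re := fun τ hτ =>
    (im₁ ▸ mem_image_of_mem ℓ hτ : ℓ τ ∈ {v ∈ oval t | 0 ≤ v.re}).2
  have inj : InjOn ℓ (Ico 0 1) := by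
    have harc := arc_injOn ht ht4
    intro a ha b hb hab
    rcases le_or_gt a (1 / 2) with ha' | ha' <;> rcases le_or_gt b (1 / 2) with hb' | hb'
    · rw [hℓ₁ a ⟨ha.1, ha'⟩, hℓ₁ b ⟨hb.1, hb'⟩] at hab
      have := harc (sq_lt_of_mem_Icc (m₁ a ⟨ha.1, ha'⟩)) (sq_lt_of_mem_Icc (m₁ b ⟨hb.1, hb'⟩)) hab
      have := mul_right_cancel₀ hS.ne' this
      linarith
    · have := hre b ⟨hb', hb.2⟩
      rw [← hab] at this
      linarith [hre' a ⟨ha.1, ha'⟩]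
    · have := hre a ⟨ha', ha.2⟩
      rw [hab] at this
      linarith [hre' b ⟨hb.1, hb'⟩]
    · rw [hℓ₂ a ⟨ha'.le, ha.2.le⟩, hℓ₂ b ⟨hb'.le, hb.2.le⟩] at hab
      have hab' := (starRingEnd ℂ).injective (neg_injective hab)
      have := harc (sq_lt_of_mem_Icc (m₂ a ⟨ha'.le, ha.2.le⟩))
        (sq_lt_of_mem_Icc (m₂ b ⟨hb'.le, hb.2.le⟩)) hab'
      have := mul_right_cancel₀ hS.ne' this
      linarith
  have piece : ∀ (a b : ℝ) (g : ℝ → ℂ), a < b → Icc a b ⊆ Icc 0 1 →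
      (∀ τ ∈ Icc a b, ContDiffAt ℝ 1 g τ ∧ ∃ g', HasDerivAt g g' τ ∧ g' ≠ 0) →
      (∀ τ ∈ Icc a b, ℓ τ = g τ) →
      ContDiffOn ℝ 1 (fun τ => 2 / (ℓ τ + 1)) (Icc a b) ∧ ∀ s ∈ Icc a b,
        derivWithin (fun τ => 2 / (ℓ τ + 1)) (Icc a b) s ≠ 0 := by
    intro a b g hab hsub hg heq
    have hcongr : EqOn (fun τ => 2 / (ℓ τ + 1)) (fun τ => 2 / (g τ + 1)) (Icc a b) :=
      fun τ hτ => by simp only [heq τ hτ]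
    have hne' : ∀ τ ∈ Icc a b, g τ ≠ -1 := fun τ hτ => heq τ hτ ▸ hne τ (hsub hτ)
    constructor
    · exact ContDiffOn.congr (fun τ hτ =>
        (contDiffAt_two_div (hg τ hτ).1 (hne' τ hτ)).contDiffWithinAt) hcongr
    · intro s hs
      obtain ⟨hcd, g', hg', h0⟩ := hg s hs
      rw [derivWithin_congr hcongr (hcongr hs), DifferentiableAt.derivWithin
        ((contDiffAt_two_div hcd (hne' s hs)).differentiableAt one_ne_zero)
        ((uniqueDiffOn_Icc hab) s hs)]
      exact deriv_two_div_ne_zero hg' (hne' s hs) h0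
  obtain ⟨p₁, q₁⟩ := piece 0 (1 / 2) g₁ (by norm_num) (hsplit ▸ subset_union_left) d₁ hℓ₁
  obtain ⟨p₂, q₂⟩ := piece (1 / 2) 1 g₂ (by norm_num) (hsplit ▸ subset_union_right) d₂ hℓ₂
  refine ⟨fun τ => 2 / (ℓ τ + 1), ?_, ?_, ?_, ?_, 2, fun i => i / 2, by simp, by simp, ?_⟩
  · rw [hsplit]
    exact p₁.continuousOn.union_of_isClosed p₂.continuousOn isClosed_Icc isClosed_Icc
  · have : ℓ 0 = ℓ 1 := by
      rw [hℓ₁ 0 (by norm_num), hℓ₂ 1 (by norm_num)]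
      simp only [hg₁, hg₂]
      norm_num
      rw [hSdef, arc_neg_sqrt ht]
      simp
    simp only [this]
  · exact two_div_injOn.comp inj fun τ hτ => hne τ (Ico_subset_Icc_self hτ)
  · rw [curveSet_eq_image ht ht4, ← him, image_image]
  · intro i hi
    interval_cases i
    · norm_num at p₁ q₁ ⊢
      exact ⟨p₁, q₁⟩
    · norm_num at p₂ q₂ ⊢
      exact ⟨p₂, q₂⟩

theorem isCurve_curveSet {t : ℝ} (ht : 0 < t) (ht4 : t < 4) : IsCurve t (curveSet t) where
  isPiecewiseSmoothJordanCurve := isPiecewiseSmoothJordanCurve_curveSet ht ht4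
  norm_h _ hz := norm_h_of_mem_curveSet ht hz
  encircles := encircles_curveSet ht ht4
  disjoint := curveSet_disjoint ht ht4

/-! ### Uniqueness of the curve -/

theorem exists_lt_of_injOn {u : ℝ → ℝ} {a δ : ℝ} (hδ : 0 < δ)
    (hc : ContinuousOn u (Icc (a - δ) (a + δ))) (hi : InjOn u (Icc (a - δ) (a + δ))) :
    ∃ b ∈ Icc (a - δ) (a + δ), u a < u b := by
  have ha : a ∈ Icc (a - δ) (a + δ) := ⟨by linarith, by linarith⟩
  rcases hc.strictMonoOn_of_injOn_Icc' (by linarith) hi with h | h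
  · exact ⟨a + δ, ⟨by linarith, le_rfl⟩, h ha ⟨by linarith, le_rfl⟩ (by linarith)⟩
  · exact ⟨a - δ, ⟨le_rfl, by linarith⟩, h ⟨le_rfl, by linarith⟩ ha (by linarith)⟩

theorem not_isLocalMax_of_injOn {f : AddCircle (1 : ℝ) → ℝ} (hf : Continuous f)
    {x : AddCircle (1 : ℝ)} {N : Set (AddCircle (1 : ℝ))} (hN : N ∈ 𝓝 x) (hi : InjOn f N) :
    ¬ IsLocalMax f x := by
  intro hmax
  obtain ⟨a, -, rfl⟩ := AddCircle.eq_coe_Ico x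
  have hq : Continuous ((↑) : ℝ → AddCircle (1 : ℝ)) := AddCircle.continuous_mk' 1
  have hnhds : ((↑) : ℝ → AddCircle (1 : ℝ)) ⁻¹' (N ∩ {y | f y ≤ f a}) ∈ 𝓝 a :=
    hq.continuousAt.preimage_mem_nhds (inter_mem hN hmax)
  obtain ⟨ε, hε, hsub⟩ := Metric.mem_nhds_iff.1 hnhds
  -- The window has length at most `1 / 2`, less than the period, so it embeds in the circle.
  set δ := min (ε / 2) (1 / 4) with hδ
  have hδ0 : 0 < δ := by positivity
  have hδ1 : δ ≤ ε / 2 := min_le_left _ _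
  have hδ2 : δ ≤ 1 / 4 := min_le_right _ _
  have hmem : ∀ b ∈ Icc (a - δ) (a + δ), (b : AddCircle (1 : ℝ)) ∈ N ∧ f b ≤ f a := by
    intro b hb
    refine hsub ?_
    rw [Metric.mem_ball, Real.dist_eq, abs_lt]
    exact ⟨by linarith [hb.1], by linarith [hb.2]⟩
  have hinj : InjOn (fun b : ℝ => f b) (Icc (a - δ) (a + δ)) := by
    intro b hb c hc hbc
    have := hi (hmem b hb).1 (hmem c hc).1 hbc
    exact (AddCircle.coe_eq_coe_iff_of_mem_Ico (p := (1 : ℝ)) (a := a - δ)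
      ⟨hb.1, by linarith [hb.2]⟩ ⟨hc.1, by linarith [hc.2]⟩).1 this
  obtain ⟨b, hb, hlt⟩ := exists_lt_of_injOn hδ0 (hf.comp hq).continuousOn hinj
  exact absurd hlt (not_lt.2 (hmem b hb).2)

theorem eq_of_sq_eq_of_mul_pos {a b c : ℝ} (h : a ^ 2 = b ^ 2) (ha : 0 < a * c)
    (hb : 0 < b * c) : a = b := by
  rcases sq_eq_sq_iff_eq_or_eq_neg.1 h with h | h
  · exact h
  · rw [h] at ha
    linarith

section Loop

variable {t : ℝ} {W : AddCircle (1 : ℝ) → ℂ}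

/-- `σ = 1` concerns the axis outside the oval and `σ = -1` the axis inside it. Near a point of the
loop maximizing `σ y ^ 2` over the relevant axis points, the loop stays on the axis and `y` keeps
its sign, since `W` avoids `0`; so `σ y ^ 2` is injective there and cannot have a local maximum. -/
theorem loop_not_mem_whisker (ht : 0 < t) (hc : Continuous W) (hi : Function.Injective W)
    (hW : ∀ s, (W s).re = 0 ∨ W s ∈ oval t) (h0 : ∀ s, W s ≠ 0) {σ : ℝ} (hσ : σ ≠ 0)
    {s₀ : AddCircle (1 : ℝ)} (hre : (W s₀).re = 0)
    (hs₀ : 0 < σ * ((W s₀).im ^ 2 - levelFun t 0)) : False := by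
  have cre : Continuous fun s => (W s).re := Complex.continuous_re.comp hc
  have cim : Continuous fun s => (W s).im := Complex.continuous_im.comp hc
  have cF : Continuous fun s => levelFun t (W s).re := (continuous_levelFun ht).comp cre
  set K : Set (AddCircle (1 : ℝ)) :=
    {s | (W s).re = 0 ∧ 0 ≤ σ * ((W s).im ^ 2 - levelFun t 0)} with hK
  have g₁ : Continuous fun s => σ * ((W s).im ^ 2 - levelFun t 0) := by fun_prop
  have g₂ : Continuous fun s => σ * ((W s).im ^ 2 - levelFun t (W s).re) := by fun_prop
  have hKc : IsCompact K :=
    ((isClosed_eq cre continuous_const).inter (isClosed_le continuous_const g₁)).isCompact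
  have cf : Continuous fun s => σ * (W s).im ^ 2 := by fun_prop
  obtain ⟨s, hsK, hsmax⟩ := hKc.exists_isMaxOn ⟨s₀, hre, hs₀.le⟩ cf.continuousOn
  have hpos : 0 < σ * ((W s).im ^ 2 - levelFun t 0) := by
    have : σ * (W s₀).im ^ 2 ≤ σ * (W s).im ^ 2 := hsmax (⟨hre, hs₀.le⟩ : s₀ ∈ K)
    linarith
  have him : (W s).im ≠ 0 := fun h => h0 s (Complex.ext hsK.1 h)
  have hpos' : 0 < σ * ((W s).im ^ 2 - levelFun t (W s).re) := by rwa [hsK.1]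
  set N : Set (AddCircle (1 : ℝ)) := {r | 0 < σ * ((W r).im ^ 2 - levelFun t 0) ∧
    0 < σ * ((W r).im ^ 2 - levelFun t (W r).re) ∧ 0 < (W r).im * (W s).im} with hN
  have hNo : IsOpen N :=
    (isOpen_lt continuous_const g₁).inter ((isOpen_lt continuous_const g₂).inter
      (isOpen_lt continuous_const (cim.mul_const _)))
  have hNs : N ∈ 𝓝 s := hNo.mem_nhds ⟨hpos, hpos', mul_self_pos.2 him⟩
  have hNre : ∀ r ∈ N, (W r).re = 0 := by
    rintro r ⟨-, h2, -⟩
    refine (hW r).resolve_right fun h => ?_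
    rw [mem_oval.1 h, sub_self, mul_zero] at h2
    exact lt_irrefl _ h2
  refine not_isLocalMax_of_injOn cf hNs ?_ ?_
  · intro r hr q hq hrq
    apply hi
    apply Complex.ext
    · rw [hNre r hr, hNre q hq]
    · exact eq_of_sq_eq_of_mul_pos (mul_left_cancel₀ hσ hrq) hr.2.2 hq.2.2
  · filter_upwards [hNs] with r hr
    exact hsmax ⟨hNre r hr, hr.1.le⟩

theorem loop_mem_oval (ht : 0 < t) (hc : Continuous W) (hi : Function.Injective W)
    (hW : ∀ s, (W s).re = 0 ∨ W s ∈ oval t) (h0 : ∀ s, W s ≠ 0) (s : AddCircle (1 : ℝ)) :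
    W s ∈ oval t := by
  by_contra h
  have hre := (hW s).resolve_right h
  rw [mem_oval, hre] at h
  rcases lt_or_gt_of_ne h with h | h
  · exact loop_not_mem_whisker ht hc hi hW h0 (σ := -1) (by norm_num) hre (by linarith)
  · exact loop_not_mem_whisker ht hc hi hW h0 (σ := 1) (by norm_num) hre (by linarith)

/-- Away from the two vertices the real part is a local coordinate on the oval, so its maximum on
the loop is at a vertex; a maximum at the left vertex would make the loop constant. -/
theorem exists_loop_re_eq_endpt (ht : 0 < t) (ht4 : t < 4) (hc : Continuous W)
    (hi : Function.Injective W) (hW : ∀ s, W s ∈ oval t) : ∃ s, (W s).re = endpt t := by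
  have cre : Continuous fun s => (W s).re := Complex.continuous_re.comp hc
  have cim : Continuous fun s => (W s).im := Complex.continuous_im.comp hc
  obtain ⟨s, -, hs⟩ := isCompact_univ.exists_isMaxOn univ_nonempty cre.continuousOn
  have hmax : ∀ r, (W r).re ≤ (W s).re := fun r => hs (mem_univ r)
  refine ⟨s, ?_⟩
  by_contra hne
  have hle := fun r => abs_le.1 (abs_re_le_of_mem_oval ht ht4 (hW r))
  have hlt := lt_of_le_of_ne (hle s).2 hne
  rcases (hle s).1.eq_or_lt with h | h
  · have hconst : ∀ r, W r = -endpt t := by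
      intro r
      have hr : (W r).re = -endpt t := le_antisymm (h ▸ hmax r) (hle r).1
      have hr2 := mem_oval.1 (hW r)
      rw [hr, levelFun_neg, levelFun_endpt ht] at hr2
      apply Complex.ext
      · simpa using hr
      · simpa using hr2
    have h2 : ((0 : ℝ) : AddCircle (1 : ℝ)) = ((1 / 2 : ℝ) : AddCircle (1 : ℝ)) :=
      hi ((hconst _).trans (hconst _).symm)
    rw [AddCircle.coe_eq_coe_iff_of_mem_Ico (a := 0) (by norm_num) (by norm_num)] at h2
    norm_num at h2
  · have him := im_ne_zero_of_mem_oval ht ht4 (hW s) (abs_lt.2 ⟨h, hlt⟩)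
    have hN : {r | 0 < (W r).im * (W s).im} ∈ 𝓝 s :=
      (isOpen_lt continuous_const (by fun_prop)).mem_nhds (mul_self_pos.2 him)
    refine not_isLocalMax_of_injOn cre hN ?_ (Eventually.of_forall hmax)
    intro r hr q hq hrq
    apply hi
    refine Complex.ext hrq (eq_of_sq_eq_of_mul_pos ?_ hr hq)
    rw [mem_oval.1 (hW r), mem_oval.1 (hW q)]
    exact congrArg _ hrq

/-- The loop passes through both vertices. Each of its two arcs between them attains every
intermediate abscissa, at different points by injectivity, and the oval has only two points `x ± i
y` over an abscissa. -/
theorem range_loop_eq_oval (ht : 0 < t) (ht4 : t < 4) (hc : Continuous W)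
    (hi : Function.Injective W) (hW : ∀ s, W s ∈ oval t) : range W = oval t := by
  refine Subset.antisymm (range_subset_iff.2 hW) fun v hv => ?_
  have hx := endpt_pos t
  obtain ⟨s₁, hs₁⟩ := exists_loop_re_eq_endpt ht ht4 hc hi hW
  obtain ⟨s₂, hs₂⟩ := exists_loop_re_eq_endpt ht ht4 (W := fun s => -W s) hc.neg
    (neg_injective.comp hi) fun s => neg_mem_oval (hW s)
  rw [Complex.neg_re] at hs₂
  have hreal : ∀ u ∈ oval t, |u.re| = endpt t → u.im = 0 := by
    intro u hu h
    have := mem_oval.1 hu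
    rw [← abs_re_eq_of_mem_oval ht ht4 (v := (endpt t : ℂ))
      (by simp [mem_oval, levelFun_endpt ht]) (by simp)] at h
    have h3 : levelFun t u.re = 0 := by
      rcases abs_eq_abs.1 h with h | h <;> rw [h] <;> simp [levelFun_neg, levelFun_endpt ht]
    rw [h3] at this
    simpa using this
  rcases (abs_re_le_of_mem_oval ht ht4 hv).eq_or_lt with h | h
  · have hv0 := hreal v hv h
    rcases abs_eq hx.le |>.1 h with h | h
    · exact ⟨s₁, Complex.ext (hs₁.trans h.symm)
        ((hreal _ (hW s₁) (by rw [hs₁, abs_of_pos hx])).trans hv0.symm)⟩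
    · have hs₂' : (W s₂).re = -endpt t := by linarith
      exact ⟨s₂, Complex.ext (hs₂'.trans h.symm)
        ((hreal _ (hW s₂) (by rw [hs₂', abs_neg, abs_of_pos hx])).trans hv0.symm)⟩
  · obtain ⟨a, -, rfl⟩ := AddCircle.eq_coe_Ico s₁
    obtain ⟨b, hb, rfl⟩ : ∃ b ∈ Ico a (a + 1), (b : AddCircle (1 : ℝ)) = s₂ :=
      ⟨_, (AddCircle.equivIco 1 a s₂).2, AddCircle.coe_equivIco⟩
    have hq : Continuous fun r : ℝ => (W r).re :=
      Complex.continuous_re.comp (hc.comp (AddCircle.continuous_mk' 1))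
    have hend : (W ((a + 1 : ℝ) : AddCircle (1 : ℝ))).re = endpt t := by
      rw [AddCircle.coe_add, AddCircle.coe_period, add_zero, hs₁]
    rw [abs_lt] at h
    obtain ⟨r₁, hr₁, e₁⟩ := intermediate_value_Ioo' hb.1 hq.continuousOn
      (show v.re ∈ Ioo _ _ from ⟨by linarith, by linarith⟩)
    obtain ⟨r₂, hr₂, e₂⟩ := intermediate_value_Ioo hb.2.le hq.continuousOn
      (show v.re ∈ Ioo _ _ from ⟨by linarith, by linarith⟩)
    simp only at e₁ e₂
    have hne : W r₁ ≠ W r₂ := by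
      intro h
      have := (AddCircle.coe_eq_coe_iff_of_mem_Ico (p := (1 : ℝ)) (a := a)
        ⟨hr₁.1.le, hr₁.2.trans hb.2⟩ ⟨hb.1.trans hr₂.1.le, hr₂.2⟩).1 (hi h)
      linarith [hr₁.2, hr₂.1]
    have q₁ : (W r₁).im ^ 2 = v.im ^ 2 := by rw [mem_oval.1 (hW _), e₁, mem_oval.1 hv]
    have q₂ : (W r₂).im ^ 2 = v.im ^ 2 := by rw [mem_oval.1 (hW _), e₂, mem_oval.1 hv]
    rcases sq_eq_sq_iff_eq_or_eq_neg.1 q₁ with h1 | h1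
    · exact ⟨r₁, Complex.ext e₁ h1⟩
    · rcases sq_eq_sq_iff_eq_or_eq_neg.1 q₂ with h2 | h2
      · exact ⟨r₂, Complex.ext e₂ h2⟩
      · exact absurd (Complex.ext (e₁.trans e₂.symm) (h1.trans h2.symm)) hne

end Loop

theorem IsCurve.eq_curveSet {t : ℝ} (ht : 0 < t) (ht4 : t < 4) {γ : Set ℂ}
    (hγ : IsCurve t γ) : γ = curveSet t := by
  obtain ⟨c, hcc, hc01, hcinj, hcim, -⟩ := hγ.isPiecewiseSmoothJordanCurve
  have hγ0 : ∀ z ∈ γ, z ≠ 0 := fun z hz h => hγ.encircles.1 (h ▸ hz)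
  have hcγ : ∀ τ ∈ Icc (0 : ℝ) 1, c τ ∈ γ := fun τ hτ => hcim ▸ mem_image_of_mem c hτ
  have hinj : ∀ z ∈ γ, ∀ y ∈ γ, 2 / z - 1 = 2 / y - 1 → z = y := by
    intro z hz y hy h
    have hz0 := hγ0 z hz
    have hy0 := hγ0 y hy
    field_simp at h
    linear_combination -h / 2
  set W : AddCircle (1 : ℝ) → ℂ := AddCircle.liftIco 1 0 fun τ => 2 / c τ - 1 with hW
  have hWapply : ∀ τ ∈ Ico (0 : ℝ) 1, W τ = 2 / c τ - 1 := fun τ hτ =>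
    AddCircle.liftIco_coe_apply (by simpa using hτ)
  have hWc : Continuous W := by
    refine AddCircle.liftIco_continuous (by simp [hc01]) ?_
    rw [zero_add]
    exact (continuousOn_const.div hcc fun τ hτ => hγ0 _ (hcγ τ hτ)).sub continuousOn_const
  have hWi : Function.Injective W := by
    intro x y hxy
    obtain ⟨a, ha, rfl⟩ := AddCircle.eq_coe_Ico x
    obtain ⟨b, hb, rfl⟩ := AddCircle.eq_coe_Ico y
    rw [hWapply a ha, hWapply b hb] at hxy
    rw [hcinj ha hb (hinj _ (hcγ a (Ico_subset_Icc_self ha)) _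
      (hcγ b (Ico_subset_Icc_self hb)) hxy)]
  have hrange : range W = (fun z => 2 / z - 1) '' γ := by
    ext v
    constructor
    · rintro ⟨x, rfl⟩
      obtain ⟨a, ha, rfl⟩ := AddCircle.eq_coe_Ico x
      exact ⟨c a, hcγ a (Ico_subset_Icc_self ha), (hWapply a ha).symm⟩
    · rintro ⟨z, hz, rfl⟩
      rw [← hcim] at hz
      obtain ⟨τ, hτ, rfl⟩ := hz
      rcases hτ.2.eq_or_lt with h | h
      · refine ⟨((0 : ℝ) : AddCircle (1 : ℝ)), ?_⟩
        rw [hWapply 0 (by norm_num), hc01, h]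
      · exact ⟨_, hWapply τ ⟨hτ.1, h⟩⟩
  have hlevel : ∀ x, (W x).re = 0 ∨ W x ∈ oval t := by
    intro x
    obtain ⟨z, hz, hzx⟩ : W x ∈ (fun z => 2 / z - 1) '' γ := hrange ▸ mem_range_self x
    have hz0 := hγ0 z hz
    have h1 := hγ.norm_h z hz
    simp only at hzx
    rw [h_eq_w t hz0, hzx] at h1
    refine (norm_w_eq_one_iff ht fun h => ?_).1 h1
    rw [h] at hzx
    have : 2 / z = 0 := by linear_combination hzx
    simp [hz0] at this
  -- `v = 0` is `z = 2`, which lies on the excluded ray.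
  have hne : ∀ x, W x ≠ 0 := by
    intro x hx
    obtain ⟨z, hz, hzx⟩ : W x ∈ (fun z => 2 / z - 1) '' γ := hrange ▸ mem_range_self x
    have hz0 := hγ0 z hz
    simp only at hzx
    rw [hx] at hzx
    field_simp at hzx
    have hz2 : z = ((2 : ℝ) : ℂ) := by push_cast; linear_combination -hzx
    exact Set.disjoint_left.1 hγ.disjoint hz ⟨2, by norm_num [mem_Ici], hz2.symm⟩
  have hfinal := range_loop_eq_oval ht ht4 hWc hWi (loop_mem_oval ht hWc hWi hlevel hne)
  rw [hrange] at hfinal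
  ext z
  constructor
  · intro hz
    exact ⟨hγ0 z hz, hfinal ▸ mem_image_of_mem (fun z => 2 / z - 1) hz⟩
  · rintro ⟨hz0, hz⟩
    rw [← hfinal] at hz
    obtain ⟨y, hy, hyz⟩ := hz
    have hy0 := hγ0 y hy
    simp only at hyz
    have : y = z := by
      field_simp at hyz
      linear_combination -hyz / 2
    exact this ▸ hy

/-! ### The outer part of the curve and the inverse of `h` -/

/-- The outer part of the curve, parametrized by `[-√(endpt t), √(endpt t)]`. -/
def outerArc (t s : ℝ) : ℂ := 2 / (-conj (arc t s) + 1)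

theorem neg_conj_arc_mem_oval {t : ℝ} (ht : 0 < t) (ht4 : t < 4) {s : ℝ}
    (hs : s ^ 2 < 2 * endpt t) : -conj (arc t s) ∈ oval t :=
  neg_mem_oval (conj_mem_oval (arc_mem_oval ht ht4 hs))

theorem h_outerArc {t : ℝ} (ht : 0 < t) (ht4 : t < 4) {s : ℝ} (hs : s ^ 2 < 2 * endpt t) :
    h t (outerArc t s) = (Circle.exp (angle t s) : ℂ) := by
  rw [outerArc, h_two_div t (ne_neg_one_of_mem_oval ht ht4 (neg_conj_arc_mem_oval ht ht4 hs)),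
    w_neg_conj (norm_w_arc ht ht4 hs), w_arc ht ht4 hs, Circle.coe_exp]

/-- The circle `‖z - 1‖ = 1` without `0` is the imaginary `v`-axis, so `γ_t²` corresponds to the
left half of the oval. -/
theorem one_le_norm_sub_one_iff {z : ℂ} (hz : z ≠ 0) :
    1 ≤ ‖z - 1‖ ↔ (2 / z - 1).re ≤ 0 := by
  have hn : 0 < Complex.normSq z := Complex.normSq_pos.2 hz
  have h1 : (2 / z - 1).re = 2 * z.re / Complex.normSq z - 1 := by
    simp [Complex.div_re]
  rw [h1, sub_nonpos, div_le_one hn, ← one_le_sq_iff₀ (norm_nonneg _), Complex.sq_norm,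
    Complex.normSq_apply, Complex.normSq_apply]
  simp only [Complex.sub_re, Complex.sub_im, Complex.one_re, Complex.one_im]
  constructor <;> intro h <;> linarith

theorem outerPart_curveSet {t : ℝ} (ht : 0 < t) (ht4 : t < 4) :
    outerPart (curveSet t) = outerArc t '' Icc (-√(endpt t)) (√(endpt t)) := by
  have h := image_neg_conj_arc ht ht4
  rw [Set.ext_iff] at h
  ext z
  constructor
  · rintro ⟨hz, h1⟩
    rw [one_le_norm_sub_one_iff hz.1] at h1
    obtain ⟨s, hs, hsz⟩ := (h _).2 ⟨hz.2, h1⟩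
    refine ⟨s, hs, ?_⟩
    simp only at hsz
    have := hz.1
    rw [outerArc, hsz]
    field_simp
    simp
  · rintro ⟨s, hs, rfl⟩
    obtain ⟨h1, h2⟩ := (h _).1 ⟨s, hs, rfl⟩
    have hne := ne_neg_one_of_mem_oval ht ht4 h1
    have hz := (two_div_mem_curveSet hne).2 h1
    refine ⟨hz, (one_le_norm_sub_one_iff hz.1).2 ?_⟩
    have h3 : -conj (arc t s) + 1 ≠ 0 := fun h => hne (eq_neg_of_add_eq_zero_left h)
    have h4 : 2 / (2 / (-conj (arc t s) + 1)) - 1 = -conj (arc t s) := by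
      field_simp
      ring
    change (2 / (2 / (-conj (arc t s) + 1)) - 1).re ≤ 0
    rw [h4]
    exact h2

theorem angle_mem_Icc {t : ℝ} (ht : 0 < t) (ht4 : t < 4) {s : ℝ}
    (hs : s ∈ Icc (-√(endpt t)) (√(endpt t))) : angle t s ∈ Icc (-β t) (β t) :=
  image_angle ht ht4 ▸ mem_image_of_mem _ hs

theorem circleExp_injOn {b : ℝ} (hb : b < Real.pi) :
    InjOn (fun θ : ℝ => (Circle.exp θ : ℂ)) (Icc (-b) b) := by
  intro x hx y hy hxy
  have h := Circle.ext hxy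
  rw [← Circle.arg_exp (x := x), ← Circle.arg_exp (x := y), h] <;>
    linarith [hx.1, hx.2, hy.1, hy.2]

theorem h_injOn_outerPart {t : ℝ} (ht : 0 < t) (ht4 : t < 4) :
    InjOn (h t) (outerPart (curveSet t)) := by
  rw [outerPart_curveSet ht ht4]
  rintro _ ⟨s, hs, rfl⟩ _ ⟨r, hr, rfl⟩ hsr
  rw [h_outerArc ht ht4 (sq_lt_of_mem_Icc hs), h_outerArc ht ht4 (sq_lt_of_mem_Icc hr)] at hsr
  rw [(strictMonoOn_angle ht ht4).injOn hs hr (circleExp_injOn (β_lt_pi ht4)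
    (angle_mem_Icc ht ht4 hs) (angle_mem_Icc ht ht4 hr) hsr)]

theorem h_image_outerPart {t : ℝ} (ht : 0 < t) (ht4 : t < 4) :
    h t '' outerPart (curveSet t) = h t '' curveSet t := by
  refine Subset.antisymm (image_mono fun z hz => hz.1) ?_
  rintro _ ⟨z, hz, rfl⟩
  rw [outerPart_curveSet ht ht4]
  rcases le_total (2 / z - 1).re 0 with h0 | h0
  · rw [← outerPart_curveSet ht ht4]
    exact ⟨z, ⟨hz, (one_le_norm_sub_one_iff hz.1).2 h0⟩, rfl⟩
  -- A point of the right half is replaced by its mirror image, where `w` has the same value.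
  · obtain ⟨s, hs, hsz⟩ := (Set.ext_iff.1 (image_arc ht ht4) _).2 ⟨hz.2, h0⟩
    refine ⟨_, ⟨s, hs, rfl⟩, ?_⟩
    have hs' := sq_lt_of_mem_Icc hs
    rw [h_outerArc ht ht4 hs', h_eq_w t hz.1, ← hsz, w_arc ht ht4 hs', Circle.coe_exp]

theorem h_image_curveSet {t : ℝ} (ht : 0 < t) (ht4 : t < 4) :
    h t '' curveSet t = (fun θ : ℝ => (Circle.exp θ : ℂ)) '' Icc (-β t) (β t) := by
  rw [← h_image_outerPart ht ht4, outerPart_curveSet ht ht4, ← image_angle ht ht4, image_image,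
    image_image]
  exact image_congr fun s hs => h_outerArc ht ht4 (sq_lt_of_mem_Icc hs)

/-- From `‖h t z‖ = 1` follows `‖z - 1‖ = exp (-t Re (1 / z - 1 / 2))`, and `1 / z - 1 / 2 = v / 2`
with `v = -conj (arc t s)`. -/
theorem log_norm_outerArc {t : ℝ} (ht : 0 < t) (ht4 : t < 4) {s : ℝ}
    (hs : s ^ 2 < 2 * endpt t) :
    Real.log ‖outerArc t s - 1‖ = t * (arc t s).re / 2 := by
  have hne := ne_neg_one_of_mem_oval ht ht4 (neg_conj_arc_mem_oval ht ht4 hs)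
  have h3 : -conj (arc t s) + 1 ≠ 0 := fun h => hne (eq_neg_of_add_eq_zero_left h)
  have h1 : ‖h t (outerArc t s)‖ = 1 := by rw [h_outerArc ht ht4 hs, Circle.norm_coe]
  have h2 : (t : ℂ) * (1 / outerArc t s - 1 / 2) = ((-(t / 2) : ℝ) : ℂ) * conj (arc t s) := by
    rw [outerArc]
    push_cast
    field_simp
    ring
  rw [h, h2, norm_mul, Complex.norm_exp, Complex.re_ofReal_mul, Complex.conj_re, norm_sub_rev]
    at h1
  have h4 := congrArg Real.log h1
  have h5 : ‖outerArc t s - 1‖ ≠ 0 := by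
    intro h
    rw [h, zero_mul] at h1
    exact zero_ne_one h1
  rw [Real.log_mul h5 (Real.exp_pos _).ne', Real.log_exp, Real.log_one] at h4
  linarith

theorem isArcDensity_ρ {t : ℝ} (ht : 0 < t) (ht4 : t < 4) :
    IsArcDensity t (ρ t (curveSet t)) where
  apply_angle s hs := by
    have hs' := sq_lt_of_mem_Icc hs
    have hmem : outerArc t s ∈ outerPart (curveSet t) := by
      rw [outerPart_curveSet ht ht4]
      exact mem_image_of_mem _ hs
    rw [ρ, indicator_of_mem (angle_mem_Icc ht ht4 hs), hInv₂, ← h_outerArc ht ht4 hs',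
      (h_injOn_outerPart ht ht4).leftInvOn_invFunOn hmem, log_norm_outerArc ht ht4 hs']
    field_simp
  eq_zero θ hθ := by rw [ρ, indicator_of_notMem hθ]

end FreeUnitaryBM

end

theorem mainTheorem3 (t : ℝ) (ht₀ : 0 < t) (ht₄ : t < 4) :
    -- the measure `μ_t` and the curve `γ_t` are well defined
    (∃! μ : Measure Circle, FreeUnitaryBM.IsSpectralMeasure t μ) ∧
    (∃! γ : Set ℂ, FreeUnitaryBM.IsCurve t γ) ∧
    ∀ (μ : Measure Circle) (γ : Set ℂ),
      FreeUnitaryBM.IsSpectralMeasure t μ → FreeUnitaryBM.IsCurve t γ →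
      -- `h_{t,2} : γ_t² → h_t(γ_t)` is bijective, and `h_t(γ_t)` is the arc `|θ| ≤ β(t)`
      BijOn (FreeUnitaryBM.h t) (FreeUnitaryBM.outerPart γ) (FreeUnitaryBM.h t '' γ) ∧
      FreeUnitaryBM.h t '' γ =
        (fun θ : ℝ => (Circle.exp θ : ℂ)) '' Icc (-FreeUnitaryBM.β t) (FreeUnitaryBM.β t) ∧
      -- `ρ_t` is continuous and nonnegative, with support `[-β(t), β(t)]`
      Continuous (FreeUnitaryBM.ρ t γ) ∧
      (∀ θ : ℝ, 0 ≤ FreeUnitaryBM.ρ t γ θ) ∧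
      tsupport (FreeUnitaryBM.ρ t γ) = Icc (-FreeUnitaryBM.β t) (FreeUnitaryBM.β t) ∧
      -- `μ_t` is absolutely continuous with respect to normalized Haar measure on the circle
      μ ≪ Measure.haarMeasure (⊤ : TopologicalSpace.PositiveCompacts Circle) ∧
      -- `dμ_t(θ) = ρ_t(θ) dθ`
      μ = ((volume : Measure ℝ).withDensity
        (fun θ => ENNReal.ofReal (FreeUnitaryBM.ρ t γ θ))).map Circle.exp ∧
      -- the support of `μ_t` is the arc `|θ| ≤ β(t)`
      μ.support = Circle.exp '' Icc (-FreeUnitaryBM.β t) (FreeUnitaryBM.β t) := by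
  have hρ := FreeUnitaryBM.isArcDensity_ρ ht₀ ht₄
  have hspec := hρ.isSpectralMeasure ht₀ ht₄
  refine ⟨⟨_, hspec, fun ν hν => hν.unique hspec⟩,
    ⟨_, FreeUnitaryBM.isCurve_curveSet ht₀ ht₄, fun γ hγ => hγ.eq_curveSet ht₀ ht₄⟩, ?_⟩
  intro μ γ hμ hγ
  obtain rfl := hγ.eq_curveSet ht₀ ht₄
  obtain rfl := hμ.unique hspec
  have himage := FreeUnitaryBM.h_image_outerPart ht₀ ht₄
  exact ⟨⟨himage ▸ mapsTo_image _ _, FreeUnitaryBM.h_injOn_outerPart ht₀ ht₄, himage.symm.subset⟩,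
    FreeUnitaryBM.h_image_curveSet ht₀ ht₄, hρ.continuous ht₀ ht₄, hρ.nonneg ht₀ ht₄,
    hρ.tsupport_eq ht₀ ht₄, hρ.absolutelyContinuous ht₄, rfl, hρ.support_circleMeasure ht₀ ht₄⟩
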